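/- Let $K$ be an algebraically closed field of characteristic zero. Let either (a) $f=(f_1,\dots,f_n)$, $n=3$, be forms of the same degree in $K[t_1,t_2,t_3]$ with $\gcd(f_1,f_2,f_3)=1$ such that $\mathcal S=(f_1:f_2:f_3)$ is a birational map of $\mathbb P^2(K)$; or (b) $f=(f_1,\dots,f_n)$, $n=4$, be forms of the same degree in $K[t_1,t_2,t_3]$ with $\gcd(f_1,\dots,f_4)=1$ such that $\mathcal P=(f_1:\cdots:f_4)$ is a birational parametrization of a surface in $\mathbb P^3(K)$. A base point is a point $A\in\mathbb P^2(K)$ with $f_1(A)=\dots=f_n(A)=0$. Let $x_1,\dots,x_n,y_1,\dots,y_n$ be indeterminates and consider, over the algebraic closure of $K(x_1,\dots,x_n,y_1,\dots,y_n)$, the plane curves $\mathcal C(V_1)$ and $\mathcal C(V_2)$ with $V_1=\sum_i x_if_i$ and $V_2=\sum_i y_if_i$. The map (or parametrization) is called transversal if at every base point $A$ the intersection multiplicity satisfies $$\operatorname{mult}_A(\mathcal C(V_1),\mathcal C(V_2))=\operatorname{mult}(A,\mathcal C(V_1))^2 .$$ For a base point $A$, let $T_i$ be the product of the tangents, counted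 with multiplicities, to the curve $\mathcal C(f_i)$ at $A$. Put $\epsilon_i=1$ if $\operatorname{mult}(A,\mathcal C(f_i))=\min_j \operatorname{mult}(A,\mathcal C(f_j))$ and $\epsilon_i=0$ otherwise. (If $f_i=0$, which can happen in (b), its multiplicity is $\infty$ and $T_i=0$.) Then, in both cases (a) and (b): 1. The map (parametrization) is transversal if and only if $\gcd(\epsilon_1T_1,\dots,\epsilon_nT_n)=1$ at every base point $A$; that is, the $T_i$ belonging to the curves $\mathcal C(f_i)$ of minimal multiplicity at $A$ have greatest common divisor $1$. 2. If it is transversal, then $\gcd(T_1,\dots,T_n)=1$ at every base point. 3. If at every base point the curves $\mathcal C(f_1),\dots,\mathcal C(f_n)$ all have the same multiplicity, then it is transversal if and only if $\gcd(T_1,\dots,T_n)=1$ at every base point. -/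

import Mathlib

open MvPolynomial
open scoped LinearAlgebra.Projectivization

noncomputable section

namespace BaseLocus

/-! ### Plane projective curves: multiplicity, tangents, intersection multiplicity -/

section Curves

variable {k : Type*} [Field k]

/-- The Taylor expansion `f (a + t)` of a ternary polynomial `f` at the vector `a`. -/
def taylorAt (a : Fin 3 → k) (f : MvPolynomial (Fin 3) k) : MvPolynomial (Fin 3) k :=
  aeval (fun i => X i + C (a i)) f

/-- The multiplicity of the curve `f = 0` at the point with coordinate vector `a`: the least
order of a partial derivative of `f` that does not vanish at `a`, that is the least degree of a
monomial of `f (a + t)`. It is `⊤` for `f = 0`. -/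
def multAt (a : Fin 3 → k) (f : MvPolynomial (Fin 3) k) : ℕ∞ :=
  (taylorAt a f : MvPowerSeries (Fin 3) k).order

/-- The product of the tangents, counted with multiplicities, to the curve `f = 0` at the point
with coordinate vector `a`: the form of lowest degree `m` of `f (a + t)`. By Euler's relation this
form is constant along the direction `a`, so that over an algebraically closed field it is a
product of `m` linear forms vanishing at `a`; these are the equations of the tangent lines.
For a simple point it is `∑ i, (∂f/∂tᵢ)(a) tᵢ`. -/
def tangentProduct (a : Fin 3 → k) (f : MvPolynomial (Fin 3) k) : MvPolynomial (Fin 3) k :=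
  homogeneousComponent (multAt a f).toNat (taylorAt a f)

/-- Dehomogenization with respect to the coordinate `i`, giving the equation of a curve in the
affine chart `tᵢ ≠ 0`. -/
def dehomogenize (i : Fin 3) : MvPolynomial (Fin 3) k →ₐ[k] MvPolynomial (Fin 2) k :=
  aeval (i.insertNth 1 X : Fin 3 → MvPolynomial (Fin 2) k)

/-- The affine coordinates, in the chart `tᵢ ≠ 0`, of the point with coordinate vector `a`. -/
def affinePoint (i : Fin 3) (a : Fin 3 → k) : Fin 2 → k :=
  fun j => a (i.succAbove j) / a i

/-- The ideal of the polynomials that vanish at a point of the affine plane. -/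
def pointIdeal (b : Fin 2 → k) : Ideal (MvPolynomial (Fin 2) k) :=
  RingHom.ker (aeval b : MvPolynomial (Fin 2) k →ₐ[k] k)

instance pointIdeal_isPrime (b : Fin 2 → k) : (pointIdeal b).IsPrime :=
  RingHom.ker_isPrime _

/-- The local ring of the affine plane at a point. -/
abbrev LocalRing (b : Fin 2 → k) : Type _ := Localization.AtPrime (pointIdeal b)

/-- The intersection multiplicity, computed in the chart `tᵢ ≠ 0`: the dimension over `k` of the
local ring at the point modulo the ideal generated by the dehomogenized equations. -/
def chartIntersectionMult (i : Fin 3) (a : Fin 3 → k) (f g : MvPolynomial (Fin 3) k) : ℕ∞ :=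
  Module.length k (LocalRing (affinePoint i a) ⧸
    (Ideal.span {algebraMap _ (LocalRing (affinePoint i a)) (dehomogenize i f),
      algebraMap _ (LocalRing (affinePoint i a)) (dehomogenize i g)}))

/-- A chart that contains the point with (nonzero) coordinate vector `a`. -/
def chartOf (a : Fin 3 → k) : Fin 3 := Classical.epsilon fun i => a i ≠ 0

theorem chartOf_spec {a : Fin 3 → k} (ha : a ≠ 0) : a (chartOf a) ≠ 0 :=
  Classical.epsilon_spec (p := fun i => a i ≠ 0) (Function.ne_iff.mp ha)

/-- The intersection multiplicity of the projective plane curves `f = 0` and `g = 0` at the point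
with (nonzero) coordinate vector `a`. It does not depend on the chart. -/
def intersectionMult (a : Fin 3 → k) (f g : MvPolynomial (Fin 3) k) : ℕ∞ :=
  chartIntersectionMult (chartOf a) a f g

end Curves

/-- The members of a family in a commutative ring have no common divisors but units, that is,
their greatest common divisor is `1`. -/
def GcdEqOne {ι R : Type*} [CommRing R] (f : ι → R) : Prop :=
  ∀ g : R, (∀ i, g ∣ f i) → IsUnit g

/-! ### Rational maps from the projective plane, given by forms of the same degree -/

section Maps

variable {K : Type*} [Field K] {n : ℕ}

/-- `(s₁ : s₂ : s₃)` is a birational map of the projective plane: there are forms `r₁, r₂, r₃` of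
the same degree such that `(r₁ : r₂ : r₃)` is its inverse on both sides, as a rational map. -/
def IsBirationalOfPlane (s : Fin 3 → MvPolynomial (Fin 3) K) : Prop :=
  ∃ (e : ℕ) (r : Fin 3 → MvPolynomial (Fin 3) K) (h h' : MvPolynomial (Fin 3) K),
    (∀ i, (r i).IsHomogeneous e) ∧ h ≠ 0 ∧ h' ≠ 0 ∧
    (∀ i, aeval s (r i) = h * X i) ∧ (∀ i, aeval r (s i) = h' * X i)

/-- `(p₁ : p₂ : p₃ : p₄)` is a birational parametrization of a surface in projective space, namely
of the closure of its image: a rational map `(q₁ : q₂ : q₃)`, given by forms of the same degree in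
four variables, is defined at the general point of the image and inverts the parametrization. -/
def IsBirationalSurfaceParam (p : Fin 4 → MvPolynomial (Fin 3) K) : Prop :=
  ∃ (e : ℕ) (q : Fin 3 → MvPolynomial (Fin 4) K) (h : MvPolynomial (Fin 3) K),
    (∀ i, (q i).IsHomogeneous e) ∧ h ≠ 0 ∧ ∀ i, aeval p (q i) = h * X i

/-- The base points of the rational map `(f₁ : … : fₙ)`. -/
def basePoints (f : Fin n → MvPolynomial (Fin 3) K) : Set (ℙ K (Fin 3 → K)) :=
  {A | ∀ i, eval A.rep (f i) = 0}

/-- The algebraic closure of the field of rational functions `K(x₁, …, xₙ, y₁, …, yₙ)`. -/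
abbrev GenericField (K : Type*) [Field K] (n : ℕ) : Type _ :=
  AlgebraicClosure (FractionRing (MvPolynomial (Fin n ⊕ Fin n) K))

/-- The elements `xᵢ` (for `v = Sum.inl i`) and `yᵢ` (for `v = Sum.inr i`). -/
def genericCoeff (K : Type*) [Field K] (n : ℕ) (v : Fin n ⊕ Fin n) : GenericField K n :=
  algebraMap (FractionRing (MvPolynomial (Fin n ⊕ Fin n) K)) (GenericField K n)
    (algebraMap (MvPolynomial (Fin n ⊕ Fin n) K) _ (X v))

/-- The generic combination `x₁ f₁ + … + xₙ fₙ`. -/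
def genericX (f : Fin n → MvPolynomial (Fin 3) K) : MvPolynomial (Fin 3) (GenericField K n) :=
  ∑ i, C (genericCoeff K n (Sum.inl i)) * map (algebraMap K (GenericField K n)) (f i)

/-- The generic combination `y₁ f₁ + … + yₙ fₙ`. -/
def genericY (f : Fin n → MvPolynomial (Fin 3) K) : MvPolynomial (Fin 3) (GenericField K n) :=
  ∑ i, C (genericCoeff K n (Sum.inr i)) * map (algebraMap K (GenericField K n)) (f i)

/-- A coordinate vector over `GenericField K n` of a point of the projective plane over `K`. -/
def genericRep (n : ℕ) (A : ℙ K (Fin 3 → K)) : Fin 3 → GenericField K n :=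
  fun i => algebraMap K (GenericField K n) (A.rep i)

/-- The multiplicity of the base point `A`: the intersection multiplicity at `A` of the curves
`∑ xᵢ fᵢ = 0` and `∑ yᵢ fᵢ = 0`. -/
def basePointMult (f : Fin n → MvPolynomial (Fin 3) K) (A : ℙ K (Fin 3 → K)) : ℕ∞ :=
  intersectionMult (genericRep n A) (genericX f) (genericY f)

/-- Transversality of the base locus: at each base point `A`, the multiplicity of the base point is
the square of the multiplicity at `A` of the curve `∑ xᵢ fᵢ = 0`. -/
def IsTransversal (f : Fin n → MvPolynomial (Fin 3) K) : Prop :=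
  ∀ A ∈ basePoints f, basePointMult f A = multAt (genericRep n A) (genericX f) ^ 2

/-- The product `Tᵢ` of the tangents at `A` to the curve `fᵢ = 0`. -/
def tangents (f : Fin n → MvPolynomial (Fin 3) K) (A : ℙ K (Fin 3 → K)) (i : Fin n) :
    MvPolynomial (Fin 3) K :=
  tangentProduct A.rep (f i)

open Classical in
/-- The product `εᵢ Tᵢ`: here `εᵢ = 1` if the curve `fᵢ = 0` has, among the curves `fⱼ = 0`, the
least multiplicity at `A`, and `εᵢ = 0` otherwise. -/
def minimalTangents (f : Fin n → MvPolynomial (Fin 3) K) (A : ℙ K (Fin 3 → K)) (i : Fin n) :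
    MvPolynomial (Fin 3) K :=
  if ∀ j, multAt A.rep (f i) ≤ multAt A.rep (f j) then tangents f A i else 0

/-- At each base point the curves `f₁ = 0, …, fₙ = 0` all have the same multiplicity. -/
def HasEqualMults (f : Fin n → MvPolynomial (Fin 3) K) : Prop :=
  ∀ A ∈ basePoints f, ∀ i j, multAt A.rep (f i) = multAt A.rep (f j)

end Maps

end BaseLocus

end

open MvPolynomial
open scoped LinearAlgebra.Projectivization

noncomputable section

namespace BaseLocus

/-! ### Truncated binary polynomials -/

section Origin

variable {k : Type*} [Field k]

/-- The binary polynomials of degree less than `N`. -/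
def lowDegree (k : Type*) [Field k] (N : ℕ) : Submodule k (MvPolynomial (Fin 2) k) :=
  restrictSupport k {s | s.degree < N}

theorem mem_lowDegree {N : ℕ} {p : MvPolynomial (Fin 2) k} :
    p ∈ lowDegree k N ↔ ∀ s : Fin 2 →₀ ℕ, N ≤ s.degree → p.coeff s = 0 := by
  rw [lowDegree, mem_restrictSupport_iff]
  simp only [Set.subset_def, Finset.mem_coe, mem_support_iff, Set.mem_ofPred_eq]
  exact forall_congr' fun s => by rw [← not_lt, not_imp_comm]

theorem mem_lowDegree_iff_homogeneousComponent {N : ℕ} {p : MvPolynomial (Fin 2) k} :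
    p ∈ lowDegree k N ↔ ∀ j, N ≤ j → homogeneousComponent j p = 0 := by
  rw [mem_lowDegree]
  constructor
  · intro h j hj
    ext s
    rw [coeff_homogeneousComponent, coeff_zero]
    split_ifs with hs
    · exact h s (hs ▸ hj)
    · rfl
  · intro h s hs
    have := congrArg (coeff s) (h _ hs)
    simpa [coeff_homogeneousComponent] using this

theorem mem_idealOfVars_pow_iff_homogeneousComponent {σ : Type*} {N : ℕ} {p : MvPolynomial σ k} :
    p ∈ idealOfVars σ k ^ N ↔ ∀ j < N, homogeneousComponent j p = 0 := by
  rw [mem_pow_idealOfVars_iff']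
  constructor
  · intro h j hj
    ext s
    rw [coeff_homogeneousComponent, coeff_zero]
    split_ifs with hs
    · exact h s (hs ▸ hj)
    · rfl
  · intro h s hs
    have := congrArg (coeff s) (h _ hs)
    simpa [coeff_homogeneousComponent] using this

theorem isHomogeneous_mem_idealOfVars_pow {σ : Type*} {N : ℕ} {p : MvPolynomial σ k}
    (hp : p.IsHomogeneous N) : p ∈ idealOfVars σ k ^ N := by
  rw [mem_pow_idealOfVars_iff']
  intro s hs
  exact hp.coeff_eq_zero hs.ne

theorem sub_homogeneousComponent_mem {σ : Type*} {m : ℕ} {p : MvPolynomial σ k}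
    (hp : p ∈ idealOfVars σ k ^ m) : p - homogeneousComponent m p ∈ idealOfVars σ k ^ (m + 1) := by
  rw [mem_pow_idealOfVars_iff'] at *
  intro s hs
  rw [coeff_sub, coeff_homogeneousComponent]
  split_ifs with h
  · simp
  · rw [hp s (by omega), sub_zero]

theorem isHomogeneous_eq_zero_of_mem {σ : Type*} {m : ℕ} {p : MvPolynomial σ k}
    (hp : p.IsHomogeneous m) (h : p ∈ idealOfVars σ k ^ (m + 1)) : p = 0 := by
  rw [mem_pow_idealOfVars_iff'] at h
  ext s
  by_cases hs : s.degree = m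
  · simpa using h s (by omega)
  · simpa using hp.coeff_eq_zero hs

theorem isCompl_lowDegree (N : ℕ) :
    IsCompl (((idealOfVars (Fin 2) k) ^ N).restrictScalars k) (lowDegree k N) := by
  constructor
  · rw [Submodule.disjoint_def]
    intro p hp hp'
    rw [Submodule.restrictScalars_mem, mem_pow_idealOfVars_iff'] at hp
    rw [mem_lowDegree] at hp'
    ext s
    rcases lt_or_ge s.degree N with h | h
    · simpa using hp s h
    · simpa using hp' s h
  · rw [codisjoint_iff, eq_top_iff]
    intro p _
    rw [p.as_sum]
    refine Submodule.sum_mem _ fun s _ => ?_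
    rcases lt_or_ge s.degree N with h | h
    · exact Submodule.mem_sup_right ((monomial_mem_restrictSupport (R := k)).mpr (Or.inl h))
    · refine Submodule.mem_sup_left ?_
      rw [Submodule.restrictScalars_mem, mem_pow_idealOfVars_iff']
      intro t ht
      rw [coeff_monomial, if_neg]
      rintro rfl
      omega

instance (N : ℕ) : Finite {s : Fin 2 →₀ ℕ | s.degree < N} := by
  refine Set.Finite.subset
    (s := ⋃ j ∈ Finset.range N, (Finset.finsuppAntidiag Finset.univ j : Finset (Fin 2 →₀ ℕ)))
    (Set.Finite.biUnion (Finset.finite_toSet _) fun _ _ => Finset.finite_toSet _) ?_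
  intro s hs
  simp only [Set.mem_iUnion, Finset.mem_coe, Finset.mem_range, Finset.mem_finsuppAntidiag]
  exact ⟨s.degree, hs, by rw [Finsupp.degree_eq_sum], Finset.subset_univ _⟩

instance (N : ℕ) : Module.Finite k (lowDegree k N) :=
  Module.Finite.of_basis (basisRestrictSupport k _)

theorem finrank_lowDegree (N : ℕ) :
    Module.finrank k (lowDegree k N) = ∑ j ∈ Finset.range N, (j + 1) := by
  have e : {s : Fin 2 →₀ ℕ | s.degree < N} ≃
      (Finset.range N).sigma fun j => Finset.HasAntidiagonal.antidiagonal j :=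
    { toFun := fun s => ⟨⟨s.1.degree, (s.1 0, s.1 1)⟩, by
        have := s.2
        simp only [Finset.mem_sigma, Finset.mem_range, Finset.HasAntidiagonal.mem_antidiagonal]
        exact ⟨this, by simp [Finsupp.degree_eq_sum]⟩⟩
      invFun := fun x => ⟨Finsupp.equivFunOnFinite.symm ![x.1.2.1, x.1.2.2], by
        have := x.2
        simp only [Finset.mem_sigma, Finset.mem_range,
          Finset.HasAntidiagonal.mem_antidiagonal] at this
        simp [Finsupp.degree_eq_sum, this]⟩
      left_inv := fun s => by
        ext i
        fin_cases i <;> simp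
      right_inv := fun x => by
        obtain ⟨⟨j, a, b⟩, hx⟩ := x
        simp only [Finset.mem_sigma, Finset.mem_range,
          Finset.HasAntidiagonal.mem_antidiagonal] at hx
        obtain ⟨_, rfl⟩ := hx
        simp [Finsupp.degree_eq_sum] }
  rw [lowDegree,
    Module.finrank_eq_nat_card_basis (basisRestrictSupport k {s : Fin 2 →₀ ℕ | s.degree < N}),
    Nat.card_congr e, Nat.card_eq_fintype_card, Fintype.card_coe, Finset.card_sigma]
  simp

theorem finrank_lowDegree_mul_two (N : ℕ) :
    2 * Module.finrank k (lowDegree k N) = N * (N + 1) := by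
  rw [finrank_lowDegree]
  induction N with
  | zero => simp
  | succ N ih => rw [Finset.sum_range_succ, mul_add, ih]; ring

/-- Polynomials modulo a power of the ideal of the origin are the truncated polynomials. -/
def quotientPowEquiv (N : ℕ) :
    (MvPolynomial (Fin 2) k ⧸ idealOfVars (Fin 2) k ^ N) ≃ₗ[k] lowDegree k N :=
  (Submodule.Quotient.restrictScalarsEquiv k (idealOfVars (Fin 2) k ^ N)).symm ≪≫ₗ
    Submodule.quotientEquivOfIsCompl _ _ (isCompl_lowDegree N)

instance (N : ℕ) : Module.Finite k (MvPolynomial (Fin 2) k ⧸ idealOfVars (Fin 2) k ^ N) :=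
  Module.Finite.equiv (quotientPowEquiv N).symm

instance (N : ℕ) (I : Ideal (MvPolynomial (Fin 2) k)) :
    Module.Finite k (MvPolynomial (Fin 2) k ⧸ (I ⊔ idealOfVars (Fin 2) k ^ N)) :=
  Module.Finite.of_surjective
    (Ideal.Quotient.factorₐ k (le_sup_right : idealOfVars (Fin 2) k ^ N ≤ I ⊔ _)).toLinearMap
    (Ideal.Quotient.factor_surjective le_sup_right)

/-! ### Dimension count for the ideal of two plane curves at the origin -/

/-- The map `(A, B) ↦ A F + B G` on truncated polynomials. -/
def truncatedCombination (N M : ℕ) (F G : MvPolynomial (Fin 2) k) :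
    (lowDegree k N × lowDegree k N) →ₗ[k] (MvPolynomial (Fin 2) k ⧸ idealOfVars (Fin 2) k ^ M) :=
  (Ideal.Quotient.mkₐ k _).toLinearMap ∘ₗ
    LinearMap.coprod (LinearMap.mulRight k F ∘ₗ (lowDegree k N).subtype)
      (LinearMap.mulRight k G ∘ₗ (lowDegree k N).subtype)

theorem truncatedCombination_apply (N M : ℕ) (F G : MvPolynomial (Fin 2) k)
    (x : lowDegree k N × lowDegree k N) :
    truncatedCombination N M F G x = Ideal.Quotient.mk _ (x.1.1 * F + x.2.1 * G) := by
  simp [truncatedCombination]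

/-- Since `F` and `G` have order at least `m`, the parts of the coefficients of degree at least `N`
contribute only to order `N + m`. -/
theorem range_truncatedCombination {m : ℕ} (N : ℕ) {F G : MvPolynomial (Fin 2) k}
    (hF : F ∈ idealOfVars (Fin 2) k ^ m) (hG : G ∈ idealOfVars (Fin 2) k ^ m) :
    LinearMap.range (truncatedCombination N (N + m) F G) =
      LinearMap.ker (Ideal.Quotient.factorₐ k
        (le_sup_right : idealOfVars (Fin 2) k ^ (N + m) ≤ Ideal.span {F, G} ⊔ _)).toLinearMap := by
  apply le_antisymm
  · rintro _ ⟨x, rfl⟩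
    rw [truncatedCombination_apply, LinearMap.mem_ker]
    change Ideal.Quotient.mk _ _ = 0
    rw [Ideal.Quotient.eq_zero_iff_mem]
    exact Submodule.mem_sup_left (Ideal.mem_span_pair.mpr ⟨_, _, rfl⟩)
  · intro q hq
    obtain ⟨p, rfl⟩ := Ideal.Quotient.mk_surjective q
    have hp : p ∈ Ideal.span {F, G} ⊔ idealOfVars (Fin 2) k ^ (N + m) := by
      rw [← Ideal.Quotient.eq_zero_iff_mem]
      exact hq
    obtain ⟨y, hy, r, hr, rfl⟩ := Submodule.mem_sup.mp hp
    obtain ⟨a, b, rfl⟩ := Ideal.mem_span_pair.mp hy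
    have key : ∀ a : MvPolynomial (Fin 2) k, ∃ a₀ ∈ lowDegree k N,
        a - a₀ ∈ idealOfVars (Fin 2) k ^ N := by
      intro a
      have : a ∈ ((idealOfVars (Fin 2) k) ^ N).restrictScalars k ⊔ lowDegree k N := by
        rw [(isCompl_lowDegree N).sup_eq_top]; trivial
      obtain ⟨a₁, h₁, a₀, h₀, rfl⟩ := Submodule.mem_sup.mp this
      exact ⟨a₀, h₀, by simpa using h₁⟩
    obtain ⟨a₀, ha₀, ha⟩ := key a
    obtain ⟨b₀, hb₀, hb⟩ := key b
    refine ⟨(⟨a₀, ha₀⟩, ⟨b₀, hb₀⟩), ?_⟩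
    rw [truncatedCombination_apply, eq_comm, Ideal.Quotient.eq]
    have : a * F + b * G + r - (a₀ * F + b₀ * G) = (a - a₀) * F + (b - b₀) * G + r := by ring
    rw [this, pow_add]
    rw [pow_add] at hr
    exact add_mem (add_mem (Ideal.mul_mem_mul ha hF) (Ideal.mul_mem_mul hb hG)) hr

/-- Rank-nullity twice: for the combination map, and for the projection whose kernel is the range of
that map. -/
theorem finrank_quotient_span_pair_sup {m : ℕ} (N : ℕ) {F G : MvPolynomial (Fin 2) k}
    (hF : F ∈ idealOfVars (Fin 2) k ^ m) (hG : G ∈ idealOfVars (Fin 2) k ^ m) :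
    Module.finrank k (MvPolynomial (Fin 2) k ⧸
        (Ideal.span {F, G} ⊔ idealOfVars (Fin 2) k ^ (N + m))) +
      2 * Module.finrank k (lowDegree k N) = Module.finrank k (lowDegree k (N + m)) +
        Module.finrank k (LinearMap.ker (truncatedCombination N (N + m) F G)) := by
  have h₁ := LinearMap.finrank_range_add_finrank_ker (truncatedCombination N (N + m) F G)
  have h₂ := LinearMap.finrank_range_add_finrank_ker (Ideal.Quotient.factorₐ k
        (le_sup_right : idealOfVars (Fin 2) k ^ (N + m) ≤ Ideal.span {F, G} ⊔ _)).toLinearMap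
  rw [← range_truncatedCombination N hF hG, LinearMap.range_eq_top.mpr
    (show Function.Surjective (Ideal.Quotient.factorₐ k _).toLinearMap from
      (Ideal.Quotient.factor_surjective le_sup_right)),
    finrank_top, (quotientPowEquiv (N + m)).finrank_eq] at h₂
  rw [Module.finrank_prod] at h₁
  omega

/-- The only relation between `F` and `G` with coefficients of degree less than `m` is the
trivial one. -/
def NoLowRelation (m : ℕ) (F G : MvPolynomial (Fin 2) k) : Prop :=
  ∀ A ∈ lowDegree k m, ∀ B ∈ lowDegree k m, A * F + B * G = 0 → A = 0 ∧ B = 0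

theorem homogeneousComponent_mul_isHomogeneous {m j : ℕ} (A : MvPolynomial (Fin 2) k)
    {F : MvPolynomial (Fin 2) k} (hF : F.IsHomogeneous m) :
    homogeneousComponent (j + m) (A * F) = homogeneousComponent j A * F := by
  conv_lhs => rw [← sum_homogeneousComponent A, Finset.sum_mul, map_sum]
  have : ∀ i, homogeneousComponent (j + m) (homogeneousComponent i A * F) =
      if i = j then homogeneousComponent j A * F else 0 := by
    intro i
    rw [homogeneousComponent_of_mem ((homogeneousComponent_isHomogeneous i A).mul hF)]
    by_cases h : i = j
    · subst h; simp
    · rw [if_neg h, if_neg (by omega)]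
  simp_rw [this]
  rw [Finset.sum_ite_eq']
  split_ifs with h
  · rfl
  · rw [homogeneousComponent_eq_zero, zero_mul]
    simpa using h

theorem isHomogeneous_mem_lowDegree {N j : ℕ} {p : MvPolynomial (Fin 2) k}
    (hp : p.IsHomogeneous j) (h : j < N) : p ∈ lowDegree k N := by
  rw [mem_lowDegree]
  intro s hs
  exact hp.coeff_eq_zero (by omega)

/-- It suffices to consider relations with homogeneous coefficients of the largest degree. -/
theorem not_noLowRelation_iff {m : ℕ} {F G : MvPolynomial (Fin 2) k}
    (hF : F.IsHomogeneous m) (hG : G.IsHomogeneous m) :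
    ¬ NoLowRelation m F G ↔ ∃ A B : MvPolynomial (Fin 2) k, ∃ j, j + 1 = m ∧ A.IsHomogeneous j ∧
      B.IsHomogeneous j ∧ A * F + B * G = 0 ∧ ¬ (A = 0 ∧ B = 0) := by
  constructor
  · intro h
    simp only [NoLowRelation, not_forall] at h
    obtain ⟨A, hA, B, hB, hAB, hne⟩ := h
    obtain ⟨j, hj⟩ : ∃ j, ¬ (homogeneousComponent j A = 0 ∧ homogeneousComponent j B = 0) := by
      by_contra! hcon
      apply hne
      rw [← sum_homogeneousComponent A, ← sum_homogeneousComponent B]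
      exact ⟨Finset.sum_eq_zero fun j _ => (hcon j).1, Finset.sum_eq_zero fun j _ => (hcon j).2⟩
    have hjm : j < m := by
      by_contra! hcon
      rw [mem_lowDegree_iff_homogeneousComponent] at hA hB
      exact hj ⟨hA j hcon, hB j hcon⟩
    have hrel := congrArg (homogeneousComponent (j + m)) hAB
    rw [map_add, homogeneousComponent_mul_isHomogeneous _ hF,
      homogeneousComponent_mul_isHomogeneous _ hG, map_zero] at hrel
    -- Multiplying by a power of a variable raises the degree of the relation from `j` to `m - 1`.
    refine ⟨X 0 ^ (m - 1 - j) * homogeneousComponent j A,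
      X 0 ^ (m - 1 - j) * homogeneousComponent j B, m - 1, by omega, ?_, ?_, ?_, ?_⟩
    · have := (isHomogeneous_X_pow (R := k) (0 : Fin 2) (m - 1 - j)).mul
        (homogeneousComponent_isHomogeneous j A)
      rwa [show m - 1 - j + j = m - 1 by omega] at this
    · have := (isHomogeneous_X_pow (R := k) (0 : Fin 2) (m - 1 - j)).mul
        (homogeneousComponent_isHomogeneous j B)
      rwa [show m - 1 - j + j = m - 1 by omega] at this
    · rw [mul_assoc, mul_assoc, ← mul_add, hrel, mul_zero]
    · simpa [X_ne_zero] using hj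
  · rintro ⟨A, B, j, hj, hA, hB, hAB, hne⟩ h
    exact hne (h A (isHomogeneous_mem_lowDegree hA (by omega)) B
      (isHomogeneous_mem_lowDegree hB (by omega)) hAB)

/-- If `A` and `B` have order at least `j < N`, the lowest part of `A F + B G` is the combination of
leading forms with coefficients `A_j`, `B_j`. It has degree `j + m < N + m`, so it vanishes, and the
order of `A` and `B` goes up. Order at least `N` and degree below `N` leave only zero. -/
theorem ker_truncatedCombination_eq_bot {m N : ℕ} (hN : N ≤ m) {F G : MvPolynomial (Fin 2) k}
    (hF : F ∈ idealOfVars (Fin 2) k ^ m) (hG : G ∈ idealOfVars (Fin 2) k ^ m)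
    (h : NoLowRelation m (homogeneousComponent m F) (homogeneousComponent m G)) :
    LinearMap.ker (truncatedCombination N (N + m) F G) = ⊥ := by
  rw [LinearMap.ker_eq_bot']
  rintro ⟨⟨A, hA⟩, ⟨B, hB⟩⟩ hAB
  rw [truncatedCombination_apply, Ideal.Quotient.eq_zero_iff_mem] at hAB
  simp only at hAB
  have key : ∀ j ≤ N, A ∈ idealOfVars (Fin 2) k ^ j ∧ B ∈ idealOfVars (Fin 2) k ^ j := by
    intro j hj
    induction j with
    | zero => simp
    | succ j ih =>
      obtain ⟨hAj, hBj⟩ := ih (by omega)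
      have hA' := sub_homogeneousComponent_mem hAj
      have hB' := sub_homogeneousComponent_mem hBj
      have hF' := sub_homogeneousComponent_mem hF
      have hG' := sub_homogeneousComponent_mem hG
      have hhom := (((homogeneousComponent_isHomogeneous j A).mul
        (homogeneousComponent_isHomogeneous m F)).add ((homogeneousComponent_isHomogeneous j B).mul
        (homogeneousComponent_isHomogeneous m G)))
      have hzero := isHomogeneous_eq_zero_of_mem hhom (by
        have e : homogeneousComponent j A * homogeneousComponent m F +
            homogeneousComponent j B * homogeneousComponent m G = (A * F + B * G) -
              ((A - homogeneousComponent j A) * F + (B - homogeneousComponent j B) * G) -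
              (homogeneousComponent j A * (F - homogeneousComponent m F) +
                homogeneousComponent j B * (G - homogeneousComponent m G)) := by ring
        rw [e]
        refine sub_mem (sub_mem (Ideal.pow_le_pow_right (by omega) hAB) ?_) ?_
        · rw [show j + m + 1 = (j + 1) + m by ring, pow_add]
          exact add_mem (Ideal.mul_mem_mul hA' hF) (Ideal.mul_mem_mul hB' hG)
        · rw [show j + m + 1 = j + (m + 1) by ring, pow_add]
          exact add_mem (Ideal.mul_mem_mul (isHomogeneous_mem_idealOfVars_pow
              (homogeneousComponent_isHomogeneous j A)) hF') (Ideal.mul_mem_mul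
            (isHomogeneous_mem_idealOfVars_pow (homogeneousComponent_isHomogeneous j B)) hG'))
      obtain ⟨h₁, h₂⟩ := h _ (isHomogeneous_mem_lowDegree
        (homogeneousComponent_isHomogeneous j A) (by omega)) _ (isHomogeneous_mem_lowDegree
        (homogeneousComponent_isHomogeneous j B) (by omega)) hzero
      rw [h₁, sub_zero] at hA'
      rw [h₂, sub_zero] at hB'
      exact ⟨hA', hB'⟩
  have hd := Submodule.disjoint_def.mp (isCompl_lowDegree (k := k) N).disjoint
  have h₁ := hd A (key N le_rfl).1 hA
  have h₂ := hd B (key N le_rfl).2 hB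
  subst h₁ h₂
  rfl

/-- For a relation of leading forms with coefficients of degree `m - 1`, what is left of `A F + B G`
has order at least `(m - 1) + (m + 1) = 2m`. -/
theorem ker_truncatedCombination_ne_bot {m : ℕ} {F G : MvPolynomial (Fin 2) k}
    (hF : F ∈ idealOfVars (Fin 2) k ^ m) (hG : G ∈ idealOfVars (Fin 2) k ^ m)
    (h : ¬ NoLowRelation m (homogeneousComponent m F) (homogeneousComponent m G)) :
    LinearMap.ker (truncatedCombination m (m + m) F G) ≠ ⊥ := by
  rw [not_noLowRelation_iff (homogeneousComponent_isHomogeneous m F)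
    (homogeneousComponent_isHomogeneous m G)] at h
  obtain ⟨A, B, j, hj, hA, hB, hAB, hne⟩ := h
  intro hbot
  have hz := LinearMap.ker_eq_bot'.mp hbot (⟨A, isHomogeneous_mem_lowDegree hA (by omega)⟩,
    ⟨B, isHomogeneous_mem_lowDegree hB (by omega)⟩) (by
      rw [truncatedCombination_apply, Ideal.Quotient.eq_zero_iff_mem]
      have e : A * F + B * G = (A * homogeneousComponent m F + B * homogeneousComponent m G) +
        (A * (F - homogeneousComponent m F) + B * (G - homogeneousComponent m G)) := by ring
      simp only
      rw [e, hAB, zero_add, show m + m = j + (m + 1) by omega, pow_add]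
      exact add_mem (Ideal.mul_mem_mul (isHomogeneous_mem_idealOfVars_pow hA)
          (sub_homogeneousComponent_mem hF))
        (Ideal.mul_mem_mul (isHomogeneous_mem_idealOfVars_pow hB)
          (sub_homogeneousComponent_mem hG)))
  apply hne
  simpa [Prod.ext_iff, Subtype.ext_iff] using hz

theorem finrank_quotient_eq_sq_of_noLowRelation {m : ℕ} {F G : MvPolynomial (Fin 2) k}
    (hF : F ∈ idealOfVars (Fin 2) k ^ m) (hG : G ∈ idealOfVars (Fin 2) k ^ m)
    (h : NoLowRelation m (homogeneousComponent m F) (homogeneousComponent m G)) :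
    Module.finrank k (MvPolynomial (Fin 2) k ⧸
        (Ideal.span {F, G} ⊔ idealOfVars (Fin 2) k ^ (m + m))) = m ^ 2 := by
  have h₁ := finrank_quotient_span_pair_sup m hF hG
  rw [ker_truncatedCombination_eq_bot le_rfl hF hG h, finrank_bot] at h₁
  have h₂ := finrank_lowDegree_mul_two (k := k) m
  have h₃ := finrank_lowDegree_mul_two (k := k) (m + m)
  nlinarith

theorem sq_lt_finrank_quotient {m : ℕ} {F G : MvPolynomial (Fin 2) k}
    (hF : F ∈ idealOfVars (Fin 2) k ^ m) (hG : G ∈ idealOfVars (Fin 2) k ^ m)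
    (h : ¬ NoLowRelation m (homogeneousComponent m F) (homogeneousComponent m G)) :
    m ^ 2 < Module.finrank k (MvPolynomial (Fin 2) k ⧸
        (Ideal.span {F, G} ⊔ idealOfVars (Fin 2) k ^ (m + m))) := by
  have h₁ := finrank_quotient_span_pair_sup m hF hG
  have h₀ : Module.finrank k (LinearMap.ker (truncatedCombination m (m + m) F G)) ≠ 0 := fun h0 =>
    ker_truncatedCombination_ne_bot hF hG h (Submodule.finrank_eq_zero.mp h0)
  have h₂ := finrank_lowDegree_mul_two (k := k) m
  have h₃ := finrank_lowDegree_mul_two (k := k) (m + m)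
  have h₄ : 0 < Module.finrank k (LinearMap.ker (truncatedCombination m (m + m) F G)) :=
    Nat.pos_of_ne_zero h₀
  nlinarith

/-- With multiplicity `m + 1`, truncating at order `2m + 1` or at `2m + 2` gives the same dimension
`(m + 1)²`, so the surjection between the two quotients is injective. This is the input for
Nakayama. -/
theorem idealOfVars_pow_le_of_noLowRelation {m : ℕ} {F G : MvPolynomial (Fin 2) k}
    (hF : F ∈ idealOfVars (Fin 2) k ^ (m + 1)) (hG : G ∈ idealOfVars (Fin 2) k ^ (m + 1))
    (h : NoLowRelation (m + 1) (homogeneousComponent (m + 1) F)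
      (homogeneousComponent (m + 1) G)) :
    idealOfVars (Fin 2) k ^ (m + (m + 1)) ≤
      Ideal.span {F, G} ⊔ idealOfVars (Fin 2) k ^ (m + 1 + (m + 1)) := by
  have h₁ := finrank_quotient_eq_sq_of_noLowRelation hF hG h
  have h₂ := finrank_quotient_span_pair_sup m hF hG
  rw [ker_truncatedCombination_eq_bot (by omega) hF hG h, finrank_bot] at h₂
  have h₃ := finrank_lowDegree_mul_two (k := k) m
  have h₄ := finrank_lowDegree_mul_two (k := k) (m + (m + 1))
  have hle : Ideal.span {F, G} ⊔ idealOfVars (Fin 2) k ^ (m + 1 + (m + 1)) ≤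
      Ideal.span {F, G} ⊔ idealOfVars (Fin 2) k ^ (m + (m + 1)) :=
    sup_le_sup_left (Ideal.pow_le_pow_right (by omega)) _
  have hinj := (LinearMap.injective_iff_surjective_of_finrank_eq_finrank
    (f := (Ideal.Quotient.factorₐ k hle).toLinearMap) (by rw [h₁]; nlinarith)).mpr
    (Ideal.Quotient.factor_surjective hle)
  intro p hp
  have : Ideal.Quotient.mk (Ideal.span {F, G} ⊔ idealOfVars (Fin 2) k ^ (m + 1 + (m + 1))) p = 0 :=
    hinj (by
      rw [map_zero]
      change Ideal.Quotient.mk _ p = 0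
      exact Ideal.Quotient.eq_zero_iff_mem.mpr (Submodule.mem_sup_right hp))
  exact Ideal.Quotient.eq_zero_iff_mem.mp this

end Origin

/-! ### Quotients of a localization at a maximal ideal -/

section Localization

variable {k P : Type*} [Field k] [CommRing P] [Algebra k P] (p : Ideal P) [hp : p.IsMaximal]

/-- Elements outside `p` are already units modulo `J`, so localizing at `p` has nothing to invert.
-/
theorem exists_mul_sub_one_mem_of_pow_le {J : Ideal P} {N : ℕ} (hJ : p ^ N ≤ J) {s : P}
    (hs : s ∉ p) : ∃ t, t * s - 1 ∈ J := by
  have h₁ : Ideal.span {s} ⊔ p ^ N = ⊤ :=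
    Ideal.sup_pow_eq_top (by
      rw [sup_comm]
      exact hp.1.2 _ (left_lt_sup.mpr fun h => hs (h (Ideal.mem_span_singleton_self s))))
  have h₂ : (1 : P) ∈ Ideal.span {s} ⊔ p ^ N := by rw [h₁]; trivial
  obtain ⟨x, hx, y, hy, hxy⟩ := Submodule.mem_sup.mp h₂
  obtain ⟨t, rfl⟩ := Ideal.mem_span_singleton'.mp hx
  refine ⟨t, ?_⟩
  rw [← hxy, sub_add_cancel_left]
  exact J.neg_mem (hJ hy)

/-- Localization at a maximal ideal does not change the quotient by an ideal that contains a power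
of the maximal ideal. -/
def quotientEquivQuotientMap (J : Ideal P) {N : ℕ} (hJ : p ^ N ≤ J) :
    (P ⧸ J) ≃ₗ[k] (Localization.AtPrime p ⧸ J.map (algebraMap P (Localization.AtPrime p))) :=
  LinearEquiv.ofBijective
    (Ideal.quotientMapₐ (R₁ := k) (I := J) (J.map (algebraMap P (Localization.AtPrime p)))
      (IsScalarTower.toAlgHom k P (Localization.AtPrime p)) Ideal.le_comap_map).toLinearMap (by
    constructor
    · rw [injective_iff_map_eq_zero]
      intro q hq
      obtain ⟨a, rfl⟩ := Ideal.Quotient.mk_surjective q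
      have ha : algebraMap P (Localization.AtPrime p) a ∈
          J.map (algebraMap P (Localization.AtPrime p)) := Ideal.Quotient.eq_zero_iff_mem.mp hq
      obtain ⟨s, hs⟩ := (IsLocalization.algebraMap_mem_map_algebraMap_iff p.primeCompl _ _ _).mp ha
      obtain ⟨hs, hsa⟩ := hs
      obtain ⟨t, ht⟩ := exists_mul_sub_one_mem_of_pow_le p hJ hs
      rw [Ideal.Quotient.eq_zero_iff_mem]
      have : a = t * (s * a) - (t * s - 1) * a := by ring
      rw [this]
      exact sub_mem (J.mul_mem_left _ hsa) (J.mul_mem_right _ ht)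
    · intro q
      obtain ⟨z, rfl⟩ := Ideal.Quotient.mk_surjective q
      obtain ⟨⟨a, s⟩, hz⟩ := IsLocalization.surj p.primeCompl z
      obtain ⟨t, ht⟩ := exists_mul_sub_one_mem_of_pow_le p hJ s.2
      refine ⟨Ideal.Quotient.mk _ (t * a), ?_⟩
      change Ideal.Quotient.mk _ (algebraMap P (Localization.AtPrime p) (t * a)) = _
      rw [Ideal.Quotient.eq, map_mul, ← hz]
      have : algebraMap P (Localization.AtPrime p) t * (z * algebraMap P _ s.1) - z =
          z * algebraMap P (Localization.AtPrime p) (t * s.1 - 1) := by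
        rw [map_sub, map_mul, map_one]; ring
      rw [this]
      exact Ideal.mul_mem_left _ _ (Ideal.mem_map_of_mem _ ht))

/-- Gives a lower bound for the intersection multiplicity even when it is infinite. -/
theorem length_quotient_sup_pow_le (I : Ideal P) (N : ℕ) :
    Module.length k (P ⧸ (I ⊔ p ^ N)) ≤
      Module.length k (Localization.AtPrime p ⧸ I.map (algebraMap P (Localization.AtPrime p))) := by
  rw [(quotientEquivQuotientMap (k := k) p (I ⊔ p ^ N) (N := N) le_sup_right).length_eq]
  have hle : I.map (algebraMap P (Localization.AtPrime p)) ≤ (I ⊔ p ^ N).map _ :=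
    Ideal.map_mono le_sup_left
  exact Module.length_le_of_surjective (Ideal.Quotient.factorₐ k hle).toLinearMap
    (Ideal.Quotient.factor_surjective hle)

theorem length_quotient_sup_pow_eq [IsNoetherianRing P] (I : Ideal P) {N : ℕ}
    (h : p ^ N ≤ I ⊔ p ^ (N + 1)) :
    Module.length k (P ⧸ (I ⊔ p ^ (N + 1))) =
      Module.length k (Localization.AtPrime p ⧸ I.map (algebraMap P (Localization.AtPrime p))) := by
  rw [(quotientEquivQuotientMap (k := k) p (I ⊔ p ^ (N + 1)) (N := N + 1) le_sup_right).length_eq]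
  have key : (p ^ N).map (algebraMap P (Localization.AtPrime p)) ≤
      I.map (algebraMap P (Localization.AtPrime p)) := by
    have : IsNoetherianRing (Localization.AtPrime p) :=
      IsLocalization.isNoetherianRing p.primeCompl _ inferInstance
    -- Nakayama: in the local ring, `p ^ N ≤ I ⊔ p * p ^ N` implies `p ^ N ≤ I`.
    refine Submodule.le_of_le_smul_of_le_jacobson_bot
      (I := p.map (algebraMap P (Localization.AtPrime p))) (IsNoetherian.noetherian _) ?_ ?_
    · rw [IsLocalRing.jacobson_eq_maximalIdeal _ bot_ne_top,
        Localization.AtPrime.map_eq_maximalIdeal]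
    · rw [smul_eq_mul, ← Ideal.map_mul, ← Ideal.map_sup, ← pow_succ']
      exact Ideal.map_mono h
  rw [Ideal.map_sup, sup_eq_left.mpr]
  exact (Ideal.map_mono (Ideal.pow_le_pow_right (Nat.le_succ N))).trans key

end Localization

/-! ### Translations of the affine plane -/

section Translate

variable {k : Type*} [Field k]

/-- The automorphism `f(u) ↦ f(b + u)`. -/
def translate {σ : Type*} (b : σ → k) : MvPolynomial σ k ≃ₐ[k] MvPolynomial σ k :=
  AlgEquiv.ofAlgHom (aeval fun i => X i + C (b i)) (aeval fun i => X i - C (b i))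
    (by ext i; simp [← algebraMap_eq]) (by ext i; simp [← algebraMap_eq])

theorem translate_apply {σ : Type*} (b : σ → k) (f : MvPolynomial σ k) :
    translate b f = aeval (fun i => X i + C (b i)) f := rfl

theorem mem_pointIdeal_iff {b : Fin 2 → k} {f : MvPolynomial (Fin 2) k} :
    f ∈ pointIdeal b ↔ translate b f ∈ idealOfVars (Fin 2) k := by
  rw [← pow_one (idealOfVars (Fin 2) k), mem_pow_idealOfVars_iff', pointIdeal, RingHom.mem_ker]
  have : aeval b f = coeff 0 (translate b f) := by
    have h : (aeval b : MvPolynomial (Fin 2) k →ₐ[k] k) =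
        (aeval (0 : Fin 2 → k)).comp (translate b : MvPolynomial (Fin 2) k →ₐ[k] _) := by
      ext i; simp [translate_apply]
    rw [h]
    simp [← constantCoeff_eq]
  rw [this]
  constructor
  · intro h s hs
    rw [(Finsupp.degree_eq_zero_iff s).mp (by omega), h]
  · intro h
    exact h 0 (by simp)

theorem pointIdeal_eq_comap (b : Fin 2 → k) :
    pointIdeal b = (idealOfVars (Fin 2) k).comap (translate b) := by
  ext f
  rw [mem_pointIdeal_iff, Ideal.mem_comap]

theorem map_pointIdeal (b : Fin 2 → k) :
    (pointIdeal b).map (translate b) = idealOfVars (Fin 2) k := by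
  rw [pointIdeal_eq_comap, Ideal.map_comap_of_surjective _ (translate b).surjective]

instance pointIdeal_isMaximal (b : Fin 2 → k) : (pointIdeal b).IsMaximal :=
  RingHom.ker_isMaximal_of_surjective _ fun c => ⟨C c, by simp⟩

/-- Translation to the origin of the truncated quotient at a point. -/
def quotientTranslateEquiv (b : Fin 2 → k) (F G : MvPolynomial (Fin 2) k) (N : ℕ) :
    (MvPolynomial (Fin 2) k ⧸ (Ideal.span {F, G} ⊔ pointIdeal b ^ N)) ≃ₐ[k]
      (MvPolynomial (Fin 2) k ⧸
        (Ideal.span {translate b F, translate b G} ⊔ idealOfVars (Fin 2) k ^ N)) :=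
  Ideal.quotientEquivAlg _ _ (translate b) (by
    change _ = Ideal.map (translate b) _
    rw [Ideal.map_sup, Ideal.map_pow, map_pointIdeal, Ideal.map_span, Set.image_pair])

/-- The length of the local ring at a point modulo two equations of multiplicity at least `m` is
`m ^ 2` if and only if the forms of degree `m` have no relation of low degree. -/
theorem length_localRing_quotient_eq_sq_iff {m : ℕ} (b : Fin 2 → k)
    {F G : MvPolynomial (Fin 2) k} (hF : translate b F ∈ idealOfVars (Fin 2) k ^ (m + 1))
    (hG : translate b G ∈ idealOfVars (Fin 2) k ^ (m + 1)) :
    Module.length k (LocalRing b ⧸ Ideal.span {algebraMap _ (LocalRing b) F,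
      algebraMap _ (LocalRing b) G}) = ((m + 1 : ℕ) : ℕ∞) ^ 2 ↔
    NoLowRelation (m + 1) (homogeneousComponent (m + 1) (translate b F))
      (homogeneousComponent (m + 1) (translate b G)) := by
  have hmap : Ideal.span {algebraMap _ (LocalRing b) F, algebraMap _ (LocalRing b) G} =
      (Ideal.span {F, G}).map (algebraMap _ (LocalRing b)) := by
    rw [Ideal.map_span, Set.image_pair]
  rw [hmap]
  constructor
  · intro h
    by_contra hcon
    have h₁ := sq_lt_finrank_quotient hF hG hcon
    have h₂ := length_quotient_sup_pow_le (k := k) (pointIdeal b) (Ideal.span {F, G})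
      (m + 1 + (m + 1))
    rw [h, (quotientTranslateEquiv b F G _).toLinearEquiv.length_eq, Module.length_eq_finrank] at h₂
    exact absurd h₁ (not_lt.mpr (by exact_mod_cast h₂))
  · intro h
    have h₁ := idealOfVars_pow_le_of_noLowRelation hF hG h
    have h₂ := length_quotient_sup_pow_eq (k := k) (pointIdeal b) (Ideal.span {F, G})
      (N := m + (m + 1)) (by
        intro f hf
        have hf' : translate b f ∈ idealOfVars (Fin 2) k ^ (m + (m + 1)) := by
          rw [← map_pointIdeal b, ← Ideal.map_pow]
          exact Ideal.mem_map_of_mem _ hf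
        have := h₁ hf'
        rw [← map_pointIdeal b, ← Ideal.map_pow, ← Set.image_pair, ← Ideal.map_span,
          ← Ideal.map_sup] at this
        obtain ⟨g, hg, hgf⟩ := (Ideal.mem_map_iff_of_surjective _ (translate b).surjective).mp this
        rw [← (translate b).injective hgf]
        convert hg using 3
        omega)
    rw [← h₂, (quotientTranslateEquiv b F G _).toLinearEquiv.length_eq, Module.length_eq_finrank,
      show m + (m + 1) + 1 = m + 1 + (m + 1) by omega,
      finrank_quotient_eq_sq_of_noLowRelation hF hG h]
    push_cast
    rfl

end Translate

/-! ### Binary forms and their zeros -/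

section BinaryForms

variable {k : Type*} [Field k]

/-- The two substitutions agree modulo `l`. -/
theorem dvd_aeval_sub_aeval {σ R S : Type*} [CommRing R] [CommRing S] [Algebra R S] {u v : σ → S}
    {l : S} (h : ∀ i, l ∣ u i - v i) (F : MvPolynomial σ R) : l ∣ aeval u F - aeval v F := by
  have key : ∀ w : σ → S, Ideal.Quotient.mkₐ R (Ideal.span {l}) (aeval w F) =
      aeval (fun i => Ideal.Quotient.mkₐ R (Ideal.span {l}) (w i)) F := fun w => by
    rw [← AlgHom.comp_apply, comp_aeval]
  have huv : (fun i => Ideal.Quotient.mkₐ R (Ideal.span {l}) (u i)) =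
      fun i => Ideal.Quotient.mkₐ R (Ideal.span {l}) (v i) := by
    funext i
    exact Ideal.Quotient.eq.mpr (Ideal.mem_span_singleton.mpr (h i))
  rw [← Ideal.mem_span_singleton, ← Ideal.Quotient.eq]
  exact (key u).trans ((congrArg (fun w => aeval w F) huv).trans (key v).symm)

theorem IsHomogeneous.aeval_mul_eq {σ R S : Type*} [Fintype σ] [CommRing R] [CommRing S]
    [Algebra R S] {m : ℕ} {F : MvPolynomial σ R} (hF : F.IsHomogeneous m) (a : σ → S) (z : S) :
    aeval (fun i => a i * z) F = aeval a F * z ^ m := by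
  rw [aeval_def, aeval_def, eval₂_eq', eval₂_eq', Finset.sum_mul]
  refine Finset.sum_congr rfl fun s hs => ?_
  simp_rw [mul_pow]
  rw [Finset.prod_mul_distrib, Finset.prod_pow_eq_pow_sum, ← Finsupp.degree_eq_sum,
    show s.degree = m from by
      by_contra h
      exact (mem_support_iff.mp hs) (hF.coeff_eq_zero h), mul_assoc]

/-- A binary form that vanishes at `(p, q)` is divisible by `q u₀ - p u₁`. -/
theorem IsHomogeneous.dvd_of_eval_eq_zero {m : ℕ} {F : MvPolynomial (Fin 2) k}
    (hF : F.IsHomogeneous m) {a : Fin 2 → k} (ha : a ≠ 0) (h : eval a F = 0) :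
    C (a 1) * X 0 - C (a 0) * X 1 ∣ F := by
  obtain ⟨j, hj⟩ := Function.ne_iff.mp ha
  -- The substitutions `u ↦ a_j u` and `u ↦ u_j a` agree modulo the linear form. The first yields
  -- `a_j ^ m F`, the second `F(a) u_j ^ m = 0`.
  have hdvd : C (a 1) * X 0 - C (a 0) * X 1 ∣
      aeval (fun i => X i * C (a j)) F - aeval (fun i => C (a i) * X j) F := by
    refine dvd_aeval_sub_aeval (fun i => ?_) F
    fin_cases i <;> fin_cases j
    · simp [mul_comm]
    · exact ⟨1, by simp; ring⟩
    · exact ⟨-1, by simp; ring⟩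
    · simp [mul_comm]
  have h₀ : aeval (fun i => (C (a i) : MvPolynomial (Fin 2) k)) F = C (eval a F) := by
    rw [← coe_aeval_eq_eval]
    exact aeval_algebraMap_apply (A := k) (MvPolynomial (Fin 2) k) a F
  rw [IsHomogeneous.aeval_mul_eq hF, IsHomogeneous.aeval_mul_eq hF, h₀, h, C_0, zero_mul, sub_zero,
    aeval_X_left_apply] at hdvd
  have hu : IsUnit (C (a j) ^ m : MvPolynomial (Fin 2) k) :=
    ((isUnit_iff_ne_zero.mpr hj).map C).pow m
  exact hu.dvd_mul_right.mp hdvd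

/-- The univariate polynomial `F(X, 1)`. -/
def toUnivariate {k : Type*} [Field k] : MvPolynomial (Fin 2) k →ₐ[k] Polynomial k :=
  aeval ![Polynomial.X, 1]

theorem eval_toUnivariate (F : MvPolynomial (Fin 2) k) (w : k) :
    (toUnivariate F).eval w = eval ![w, 1] F := by
  have : (Polynomial.aeval w).comp (toUnivariate (k := k)) = aeval ![w, 1] := by
    ext i
    fin_cases i <;> simp [toUnivariate]
  have h := DFunLike.congr_fun this F
  simpa [coe_aeval_eq_eval, Polynomial.coe_aeval_eq_eval] using h

theorem toUnivariate_apply (F : MvPolynomial (Fin 2) k) : toUnivariate F =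
    ∑ s ∈ F.support, Polynomial.C (coeff s F) * Polynomial.X ^ s 0 := by
  rw [toUnivariate, aeval_def, eval₂_eq']
  simp [Fin.prod_univ_two]

theorem map_toUnivariate {L : Type*} [Field L] [Algebra k L] (F : MvPolynomial (Fin 2) k) :
    toUnivariate (map (algebraMap k L) F) = (toUnivariate F).map (algebraMap k L) := by
  have : (toUnivariate (k := L)).toRingHom.comp (map (algebraMap k L)) =
      (Polynomial.mapRingHom (algebraMap k L)).comp (toUnivariate (k := k)).toRingHom := by
    ext i
    · simp [toUnivariate]
    · fin_cases i <;> simp [toUnivariate]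
  exact RingHom.congr_fun this F

theorem IsHomogeneous.degree_eq_of_mem_support {m : ℕ} {F : MvPolynomial (Fin 2) k}
    (hF : F.IsHomogeneous m) {s : Fin 2 →₀ ℕ} (hs : s ∈ F.support) : s 0 + s 1 = m := by
  by_contra h
  refine (mem_support_iff.mp hs) (hF.coeff_eq_zero ?_)
  rwa [Finsupp.degree_eq_sum, Fin.sum_univ_two]

theorem IsHomogeneous.natDegree_toUnivariate_le {m : ℕ} {F : MvPolynomial (Fin 2) k}
    (hF : F.IsHomogeneous m) : (toUnivariate F).natDegree ≤ m := by
  rw [toUnivariate_apply]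
  refine Polynomial.natDegree_sum_le_of_forall_le _ _ fun s hs => ?_
  refine (Polynomial.natDegree_C_mul_X_pow_le _ _).trans ?_
  have := IsHomogeneous.degree_eq_of_mem_support hF hs
  omega

/-- The top coefficient detects the zero `(1 : 0)`, which `F(X, 1)` does not see. -/
theorem IsHomogeneous.coeff_toUnivariate {m : ℕ} {F : MvPolynomial (Fin 2) k}
    (hF : F.IsHomogeneous m) : (toUnivariate F).coeff m = eval ![1, 0] F := by
  rw [toUnivariate_apply, Polynomial.finsetSum_coeff, eval_eq']
  refine Finset.sum_congr rfl fun s hs => ?_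
  have := IsHomogeneous.degree_eq_of_mem_support hF hs
  rw [Polynomial.coeff_C_mul_X_pow]
  simp only [Fin.prod_univ_two, Matrix.cons_val_zero, Matrix.cons_val_one, one_pow, one_mul]
  by_cases h : s 1 = 0
  · rw [if_pos (by omega), h, pow_zero, mul_one]
  · rw [if_neg (by omega), zero_pow h, mul_zero]

theorem IsHomogeneous.eq_zero_of_toUnivariate_eq_zero {m : ℕ} {F : MvPolynomial (Fin 2) k}
    (hF : F.IsHomogeneous m) (h : toUnivariate F = 0) : F = 0 := by
  ext s
  by_cases hs : s ∈ F.support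
  · have h₁ := congrArg (Polynomial.coeff · (s 0)) h
    rw [toUnivariate_apply] at h₁
    simp only [Polynomial.finsetSum_coeff, Polynomial.coeff_C_mul_X_pow,
      Polynomial.coeff_zero] at h₁
    rw [Finset.sum_eq_single s _ (fun h => absurd hs h), if_pos rfl] at h₁
    · simpa using h₁
    · intro t ht hts
      rw [if_neg]
      intro hst
      apply hts
      have h₂ := IsHomogeneous.degree_eq_of_mem_support hF hs
      have h₃ := IsHomogeneous.degree_eq_of_mem_support hF ht
      ext i
      fin_cases i
      · exact hst.symm
      · change t 1 = s 1; omega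
  · simpa using hs

/-- Binary forms of degree `m` over an algebraically closed field that have a nontrivial relation
with coefficients of degree less than `m` have a common zero. -/
theorem exists_common_zero_of_not_noLowRelation [IsAlgClosed k] {m : ℕ}
    {F G : MvPolynomial (Fin 2) k} (hF : F.IsHomogeneous m) (hG : G.IsHomogeneous m)
    (h : ¬ NoLowRelation m F G) :
    (∃ w, eval ![w, 1] F = 0 ∧ eval ![w, 1] G = 0) ∨
      (eval ![1, 0] F = 0 ∧ eval ![1, 0] G = 0) := by
  rw [not_noLowRelation_iff hF hG] at h
  obtain ⟨A, B, j, hj, hA, hB, hAB, hne⟩ := h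
  by_contra! hcon
  obtain ⟨h₁, h₂⟩ := hcon
  have hcop : IsCoprime (toUnivariate F) (toUnivariate G) := by
    rw [Polynomial.isCoprime_iff_aeval_ne_zero_of_isAlgClosed k k]
    intro w
    simp only [Polynomial.coe_aeval_eq_eval, eval_toUnivariate]
    by_contra! h
    exact h₁ w h.1 h.2
  have hrel := congrArg toUnivariate hAB
  rw [map_add, map_mul, map_mul, map_zero] at hrel
  have hA' := IsHomogeneous.natDegree_toUnivariate_le hA
  have hB' := IsHomogeneous.natDegree_toUnivariate_le hB
  have hdvd : ∀ {p q : Polynomial k}, p.coeff m ≠ 0 → p ∣ q → q.natDegree ≤ j → q = 0 := by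
    intro p q hp hpq hq
    by_contra hq0
    have := Polynomial.natDegree_le_of_dvd hpq hq0
    have := Polynomial.le_natDegree_of_ne_zero hp
    omega
  -- Coprimality makes `p` divide `s`, whose degree is at most `j = m - 1`, while `p` has degree at
  -- least `m`.
  have hzero : ∀ {p q r s : Polynomial k}, p.coeff m ≠ 0 → IsCoprime p q → r * p + s * q = 0 →
      s.natDegree ≤ j → r = 0 ∧ s = 0 := by
    intro p q r s hp hpq hrs hs
    have hs0 : s = 0 := hdvd hp (hpq.dvd_of_dvd_mul_right
      ⟨-r, by linear_combination hrs⟩) hs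
    refine ⟨?_, hs0⟩
    rw [hs0, zero_mul, add_zero] at hrs
    refine (mul_eq_zero.mp hrs).resolve_right ?_
    rintro rfl
    simp at hp
  apply hne
  -- The role of `p` goes to whichever of the two forms does not vanish at `(1 : 0)`.
  by_cases hF1 : eval ![1, 0] F = 0
  · obtain ⟨hb, ha⟩ := hzero (by rw [IsHomogeneous.coeff_toUnivariate hG]; exact h₂ hF1)
      hcop.symm ((add_comm _ _).trans hrel) hA'
    exact ⟨IsHomogeneous.eq_zero_of_toUnivariate_eq_zero hA ha,
      IsHomogeneous.eq_zero_of_toUnivariate_eq_zero hB hb⟩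
  · obtain ⟨ha, hb⟩ := hzero (by rw [IsHomogeneous.coeff_toUnivariate hF]; exact hF1)
      hcop hrel hB'
    exact ⟨IsHomogeneous.eq_zero_of_toUnivariate_eq_zero hA ha,
      IsHomogeneous.eq_zero_of_toUnivariate_eq_zero hB hb⟩

theorem not_gcdEqOne_of_common_zero {ι : Type*} {m : ℕ} {G : ι → MvPolynomial (Fin 2) k}
    (hG : ∀ i, (G i).IsHomogeneous m) {a : Fin 2 → k} (ha : a ≠ 0)
    (h : ∀ i, eval a (G i) = 0) : ¬ GcdEqOne G := by
  intro hgcd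
  have hu := (hgcd _ fun i => IsHomogeneous.dvd_of_eval_eq_zero (hG i) ha (h i)).map (eval a)
  simp [mul_comm] at hu

end BinaryForms

/-! ### Generic combinations of binary forms -/

section Generic

variable {K L ι : Type*} [Field K] [Field L] [Algebra K L] [Fintype ι]

/-- The combination of the members of a family with given coefficients in an extension field. -/
def combination {σ : Type*} (c : ι → L) (G : ι → MvPolynomial σ K) : MvPolynomial σ L :=
  ∑ i, C (c i) * map (algebraMap K L) (G i)

theorem combination_isHomogeneous {σ : Type*} (c : ι → L) {G : ι → MvPolynomial σ K} {m : ℕ}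
    (hG : ∀ i, (G i).IsHomogeneous m) : (combination c G).IsHomogeneous m :=
  IsHomogeneous.sum _ _ _ fun i _ => ((hG i).map _).C_mul _

theorem coeff_combination {σ : Type*} (c : ι → L) (G : ι → MvPolynomial σ K) (s : σ →₀ ℕ) :
    coeff s (combination c G) = ∑ i, coeff s (G i) • c i := by
  rw [combination, coeff_sum]
  refine Finset.sum_congr rfl fun i _ => ?_
  rw [coeff_C_mul, coeff_map, Algebra.smul_def, mul_comm]

theorem coeff_combination_eq_zero_iff {σ : Type*} {c : ι → L} (hc : LinearIndependent K c)
    (G : ι → MvPolynomial σ K) (s : σ →₀ ℕ) :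
    coeff s (combination c G) = 0 ↔ ∀ i, coeff s (G i) = 0 := by
  rw [coeff_combination]
  constructor
  · exact fun h => Fintype.linearIndependent_iff.mp hc _ h
  · intro h
    simp [h]

theorem eval_combination {σ : Type*} (c : ι → L) (G : ι → MvPolynomial σ K) (a : σ → L) :
    eval a (combination c G) = ∑ i, c i * aeval a (G i) := by
  simp [combination, eval_map, aeval_def]

/-- If `x` and `y` are together algebraically independent over an algebraically closed field, then
the common zeros of the two generic combinations are common zeros of all members of the family. -/
theorem exists_common_zero_of_generic [IsAlgClosed K] {x y : ι → L}
    (hxy : AlgebraicIndependent K (Sum.elim x y)) {p : ι → Polynomial K} {w : L}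
    (hp : ∃ i, p i ≠ 0) (hx : ∑ i, x i * Polynomial.aeval w (p i) = 0)
    (hy : ∑ i, y i * Polynomial.aeval w (p i) = 0) : ∃ w₀ : K, ∀ i, (p i).eval w₀ = 0 := by
  obtain ⟨hyK, hxS⟩ := AlgebraicIndependent.sumElim_iff.mp hxy
  set S := Algebra.adjoin K (Set.range y) with hS
  let E := Subalgebra.algebraicClosure S L
  -- The `xᵢ` stay independent over the algebraic closure of `K[y]` in `L`.
  have hxE : LinearIndependent E x := hxS.subalgebraAlgebraicClosure.linearIndependent
  -- The polynomial `∑ yᵢ pᵢ` over `K[y]` annihilates `w`; it is nonzero because the `yᵢ` are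
  -- linearly independent over `K`.
  have hwE : IsAlgebraic S w := by
    refine ⟨∑ i, Polynomial.C (⟨y i, Algebra.subset_adjoin ⟨i, rfl⟩⟩ : S) *
      (p i).map (algebraMap K S), ?_, ?_⟩
    · intro h0
      obtain ⟨i, hi⟩ := hp
      apply hi
      ext j
      have h1 := congrArg (fun q : Polynomial S => algebraMap S L (q.coeff j)) h0
      simp only [Polynomial.finsetSum_coeff, Polynomial.coeff_C_mul, Polynomial.coeff_map,
        Polynomial.coeff_zero, map_zero, map_sum, map_mul, ← IsScalarTower.algebraMap_apply] at h1
      refine Fintype.linearIndependent_iff.mp hyK.linearIndependent (fun i => (p i).coeff j) ?_ i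
      rw [← h1]
      refine Finset.sum_congr rfl fun i _ => ?_
      rw [Algebra.smul_def, mul_comm]
      rfl
    · rw [map_sum, ← hy]
      refine Finset.sum_congr rfl fun i _ => ?_
      rw [map_mul, Polynomial.aeval_C, Polynomial.aeval_map_algebraMap]
      rfl
  have hzero : ∀ i, Polynomial.aeval w (p i) = 0 := by
    let w' : E := ⟨w, hwE⟩
    have hval : ∀ i, ((Polynomial.aeval w' ((p i).map (algebraMap K S)) : E) : L) =
        Polynomial.aeval w (p i) := fun i => by
      rw [← Polynomial.aeval_map_algebraMap S w]
      exact (Polynomial.aeval_algHom_apply E.val w' _).symm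
    intro i
    have := Fintype.linearIndependent_iff.mp hxE
      (fun i => Polynomial.aeval w' ((p i).map (algebraMap K S))) (by
        rw [← hx]
        refine Finset.sum_congr rfl fun i _ => ?_
        rw [← hval i, mul_comm]
        rfl) i
    rw [← hval i, this]
    rfl
  obtain ⟨i, hi⟩ := hp
  obtain ⟨w₀, hw₀⟩ := (IsAlgClosed.splits (p i)).mem_range_of_isRoot hi (i := algebraMap K L)
    (x := w) (by simpa [Polynomial.IsRoot, Polynomial.eval_map, Polynomial.aeval_def] using hzero i)
  refine ⟨w₀, fun j => ?_⟩
  have := hzero j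
  rw [← hw₀, Polynomial.aeval_algebraMap_apply] at this
  simpa [Polynomial.coe_aeval_eq_eval] using this

/-- A common factor `g` of positive degree can be cancelled from the relation between the two
combinations that swaps them, which leaves cofactors of degree below `m + 1` as coefficients. -/
theorem gcdEqOne_of_noLowRelation_combination {x y : ι → L} {m : ℕ}
    {G : ι → MvPolynomial (Fin 2) K} (hG : ∀ i, (G i).IsHomogeneous (m + 1))
    (h : NoLowRelation (m + 1) (combination x G) (combination y G)) : GcdEqOne G := by
  intro g hg
  choose H hH using hg
  have hfac : ∀ c : ι → L, combination c G = map (algebraMap K L) g * combination c H := by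
    intro c
    simp only [combination, Finset.mul_sum]
    refine Finset.sum_congr rfl fun i _ => ?_
    rw [hH i, map_mul]; ring
  by_contra hu
  have hg0 : g ≠ 0 := by
    rintro rfl
    have hz : ∀ c : ι → L, combination c G = 0 := fun c => by rw [hfac, map_zero, zero_mul]
    have := h 1 (isHomogeneous_mem_lowDegree (isHomogeneous_one _ _) (by omega)) 0
      (Submodule.zero_mem _) (by rw [hz x, hz y, mul_zero, mul_zero, add_zero])
    exact one_ne_zero this.1
  have hdeg : 1 ≤ (map (algebraMap K L) g).totalDegree := by
    by_contra hlt
    have h0 : (map (algebraMap K L) g).totalDegree = 0 := by omega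
    rw [totalDegree_eq_zero_iff_eq_C] at h0
    apply hu
    have hgC : g = C (coeff 0 g) := by
      apply map_injective _ (algebraMap K L).injective
      rw [h0, map_C, coeff_map]
    rw [hgC]
    refine (isUnit_iff_ne_zero.mpr fun h => hg0 ?_).map C
    rw [hgC, h, C_0]
  have hgL : map (algebraMap K L) g ≠ 0 := by
    intro h
    rw [h] at hdeg
    simp at hdeg
  have hlow : ∀ c : ι → L, combination c H ∈ lowDegree L (m + 1) := by
    intro c
    by_cases h0 : combination c H = 0
    · rw [h0]; exact Submodule.zero_mem _
    have h1 := (combination_isHomogeneous c hG).totalDegree_le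
    rw [hfac, totalDegree_mul_of_isDomain hgL h0] at h1
    rw [mem_lowDegree]
    intro s hs
    apply coeff_eq_zero_of_totalDegree_lt
    rw [← Finsupp.degree_apply]
    omega
  have hrel := h _ (hlow y) _ (Submodule.neg_mem _ (hlow x)) (by rw [hfac x, hfac y]; ring)
  have hz : ∀ c : ι → L, combination c H = 0 → combination c G = 0 := fun c hc => by
    rw [hfac, hc, mul_zero]
  -- Vanishing cofactors make both combinations zero, and then `(1, 0)` is a nontrivial relation.
  have := h 1 (isHomogeneous_mem_lowDegree (isHomogeneous_one _ _) (by omega)) 0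
      (Submodule.zero_mem _) (by
        rw [hz x (neg_eq_zero.mp hrel.2), hz y hrel.1, mul_zero, mul_zero, add_zero])
  exact one_ne_zero this.1

/-- Two generic combinations of binary forms have no relation of low degree if and only if the
forms have no common divisor. -/
theorem noLowRelation_combination_iff [IsAlgClosed K] [IsAlgClosed L] {x y : ι → L}
    (hxy : AlgebraicIndependent K (Sum.elim x y)) {m : ℕ}
    {G : ι → MvPolynomial (Fin 2) K} (hG : ∀ i, (G i).IsHomogeneous (m + 1)) :
    NoLowRelation (m + 1) (combination x G) (combination y G) ↔ GcdEqOne G := by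
  refine ⟨gcdEqOne_of_noLowRelation_combination hG, fun hgcd => ?_⟩
  by_contra hcon
  have hG0 : ∃ i, toUnivariate (G i) ≠ 0 := by
    by_contra! h
    have hz : ∀ i, G i = 0 := fun i => IsHomogeneous.eq_zero_of_toUnivariate_eq_zero (hG i) (h i)
    exact not_isUnit_zero (hgcd 0 fun i => by rw [hz i])
  rcases exists_common_zero_of_not_noLowRelation (combination_isHomogeneous x hG)
    (combination_isHomogeneous y hG) hcon with ⟨w, hx, hy⟩ | ⟨hx, hy⟩
  · have hev : ∀ i, aeval ![w, 1] (G i) = Polynomial.aeval w (toUnivariate (G i)) := by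
      intro i
      rw [aeval_def, ← eval_map, ← eval_toUnivariate, map_toUnivariate, Polynomial.eval_map,
        Polynomial.aeval_def]
    rw [eval_combination] at hx hy
    simp only [hev] at hx hy
    obtain ⟨w₀, hw₀⟩ := exists_common_zero_of_generic hxy hG0 hx hy
    simp only [eval_toUnivariate] at hw₀
    exact not_gcdEqOne_of_common_zero hG (Function.ne_iff.mpr ⟨1, by simp⟩) hw₀ hgcd
  -- The zero `(1 : 0)` is rational over `K`, so independence of the `xᵢ` over `K` suffices.
  · have hxK : LinearIndependent K x :=
      (hxy.comp Sum.inl Sum.inl_injective).linearIndependent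
    refine not_gcdEqOne_of_common_zero hG (a := ![1, 0]) (Function.ne_iff.mpr ⟨0, by simp⟩) ?_ hgcd
    rw [eval_combination] at hx
    have hev : ∀ i, aeval ![(1 : L), 0] (G i) = algebraMap K L (eval ![1, 0] (G i)) := by
      intro i
      have ha : ![(1 : L), 0] = algebraMap K L ∘ ![1, 0] := by
        funext j
        fin_cases j <;> simp
      rw [ha, ← coe_aeval_eq_eval]
      exact aeval_algebraMap_apply L ![(1 : K), 0] (G i)
    refine Fintype.linearIndependent_iff.mp hxK _ ?_
    rw [← hx]
    refine Finset.sum_congr rfl fun i _ => ?_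
    rw [hev, Algebra.smul_def, mul_comm]

end Generic

/-! ### Lines through a point and the affine chart -/

section Pencil

variable {k : Type*} [Field k]

/-- The embedding of the polynomials on an affine chart that sends the `j`-th coordinate to the
equation `t_j - b_j t_i` of a line through the point `b`. -/
def lineSubst (i : Fin 3) (b : Fin 2 → k) : MvPolynomial (Fin 2) k →ₐ[k] MvPolynomial (Fin 3) k :=
  aeval fun j => X (i.succAbove j) - C (b j) * X i

/-- Setting `t_i = 0`. -/
def setZero (i : Fin 3) : MvPolynomial (Fin 3) k →ₐ[k] MvPolynomial (Fin 2) k :=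
  aeval (i.insertNth 0 X : Fin 3 → MvPolynomial (Fin 2) k)

theorem setZero_lineSubst (i : Fin 3) (b : Fin 2 → k) (G : MvPolynomial (Fin 2) k) :
    setZero i (lineSubst i b G) = G := by
  have : (setZero i).comp (lineSubst i b) = AlgHom.id k _ := by
    ext j
    simp [setZero, lineSubst]
  exact DFunLike.congr_fun this G

theorem lineSubst_injective (i : Fin 3) (b : Fin 2 → k) : Function.Injective (lineSubst i b) :=
  Function.LeftInverse.injective (setZero_lineSubst i b)

theorem setZero_rename (i : Fin 3) (G : MvPolynomial (Fin 2) k) :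
    setZero i (rename i.succAbove G) = G := by
  have : (setZero i).comp (rename i.succAbove) = AlgHom.id k (MvPolynomial (Fin 2) k) := by
    ext j
    simp [setZero]
  exact DFunLike.congr_fun this G

theorem lineSubst_isHomogeneous (i : Fin 3) (b : Fin 2 → k) {m : ℕ} {G : MvPolynomial (Fin 2) k}
    (hG : G.IsHomogeneous m) : (lineSubst i b G).IsHomogeneous m := by
  have := hG.aeval (fun j => X (i.succAbove j) - C (b j) * X i) (n := 1) fun j =>
    (isHomogeneous_X k _).sub (isHomogeneous_C_mul_X _ _)
  rwa [one_mul] at this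

/-- The linear change of coordinates that sends `t_j` to `t_j + b_j t_i`. -/
def shear (i : Fin 3) (b : Fin 2 → k) : MvPolynomial (Fin 3) k →ₐ[k] MvPolynomial (Fin 3) k :=
  aeval (i.insertNth (X i) fun j => X (i.succAbove j) + C (b j) * X i :
    Fin 3 → MvPolynomial (Fin 3) k)

theorem shear_comp_shear_neg (i : Fin 3) (b : Fin 2 → k) (f : MvPolynomial (Fin 3) k) :
    shear i (-b) (shear i b f) = f := by
  have : (shear i (-b)).comp (shear i b) = AlgHom.id k _ := by
    apply algHom_ext
    intro t
    rcases Fin.eq_self_or_eq_succAbove i t with rfl | ⟨j, rfl⟩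
    · simp [shear]
    · simp [shear, add_assoc]
  exact DFunLike.congr_fun this f

theorem shear_lineSubst (i : Fin 3) (b : Fin 2 → k) (G : MvPolynomial (Fin 2) k) :
    shear i b (lineSubst i b G) = rename i.succAbove G := by
  have : (shear i b).comp (lineSubst i b) = rename i.succAbove := by
    ext1 j
    simp [shear, lineSubst, ← algebraMap_eq]
  exact DFunLike.congr_fun this G

/-- A divisor of a nonzero polynomial that does not involve `t_i` does not involve `t_i`. -/
theorem exists_rename_of_dvd (i : Fin 3) {G : MvPolynomial (Fin 2) k} (hG : G ≠ 0)
    {g : MvPolynomial (Fin 3) k} (h : g ∣ rename i.succAbove G) :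
    ∃ g' : MvPolynomial (Fin 2) k, rename i.succAbove g' = g := by
  classical
  obtain ⟨q, hq⟩ := h
  have hne : rename i.succAbove G ≠ 0 := by
    rwa [Ne, map_eq_zero_iff _ (rename_injective _ Fin.succAbove_right_injective)]
  rw [hq] at hne
  -- The degree in `t_i` is additive on nonzero products, so it is zero for each factor.
  have hdeg : degreeOf i (rename i.succAbove G) = 0 := by
    by_contra h
    have := vars_rename i.succAbove G (mem_vars_iff_degreeOf_ne_zero.mpr h)
    obtain ⟨j, _, hj⟩ := Finset.mem_image.mp this
    exact Fin.succAbove_ne i j hj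
  rw [hq, degreeOf_mul_eq (left_ne_zero_of_mul hne) (right_ne_zero_of_mul hne)] at hdeg
  refine exists_rename_eq_of_vars_subset_range _ _ Fin.succAbove_right_injective ?_
  intro t ht
  rcases Fin.eq_self_or_eq_succAbove i t with rfl | ⟨j, rfl⟩
  · exact absurd (show degreeOf t g = 0 by omega) (mem_vars_iff_degreeOf_ne_zero.mp ht)
  · exact ⟨j, rfl⟩

/-- A shear turns the lines through the point into coordinate functions. A common divisor then
divides a nonzero polynomial free of `t_i`, hence is itself a binary polynomial. -/
theorem gcdEqOne_lineSubst_iff {ι : Type*} (i : Fin 3) (b : Fin 2 → k) {c : k} (hc : c ≠ 0)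
    (G : ι → MvPolynomial (Fin 2) k) :
    GcdEqOne (fun j => C c * lineSubst i b (G j)) ↔ GcdEqOne G := by
  constructor
  · intro h g hg
    have := (h (lineSubst i b g) fun j => ((map_dvd _ (hg j)).mul_left _)).map (setZero i)
    rwa [setZero_lineSubst] at this
  · intro h g hg
    obtain ⟨j₀, hj₀⟩ : ∃ j, G j ≠ 0 := by
      by_contra! hz
      exact not_isUnit_zero (h 0 fun j => by rw [hz j])
    have hcu : IsUnit (C c : MvPolynomial (Fin 3) k) := (isUnit_iff_ne_zero.mpr hc).map C
    have hg' : ∀ j, shear i b g ∣ rename i.succAbove (G j) := fun j => by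
      rw [← shear_lineSubst i b]
      exact map_dvd _ (hcu.dvd_mul_left.mp (hg j))
    obtain ⟨g', hgg'⟩ := exists_rename_of_dvd i hj₀ (hg' j₀)
    have hu : IsUnit g' := h g' fun j => by
      have := map_dvd (setZero i) (hg' j)
      rwa [← hgg', setZero_rename, setZero_rename] at this
    have := (hu.map (rename (R := k) i.succAbove)).map (shear i (-b))
    rwa [hgg', shear_comp_shear_neg] at this

end Pencil

/-! ### Multiplicity and tangents in an affine chart -/

section Chart

variable {k : Type*} [Field k]

/-- The equation of the curve `f = 0` in the chart `t_i ≠ 0`, with the point `a` as origin. -/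
def localEquation (i : Fin 3) (a : Fin 3 → k) (f : MvPolynomial (Fin 3) k) :
    MvPolynomial (Fin 2) k :=
  translate (affinePoint i a) (dehomogenize i f)

theorem localEquation_eq_aeval (i : Fin 3) (a : Fin 3 → k) (f : MvPolynomial (Fin 3) k) :
    localEquation i a f = aeval (i.insertNth 1 fun j => X j + C (affinePoint i a j) :
      Fin 3 → MvPolynomial (Fin 2) k) f := by
  have : (translate (affinePoint i a) : _ →ₐ[k] _).comp (dehomogenize i) =
      aeval (i.insertNth 1 fun j => X j + C (affinePoint i a j) :
        Fin 3 → MvPolynomial (Fin 2) k) := by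
    apply algHom_ext
    intro t
    rcases Fin.eq_self_or_eq_succAbove i t with rfl | ⟨j, rfl⟩ <;>
      simp [translate_apply, dehomogenize]
  exact DFunLike.congr_fun this f

theorem totalDegree_aeval_le {σ τ R : Type*} [Fintype σ] [CommRing R] {u : σ → MvPolynomial τ R}
    (hu : ∀ i, (u i).totalDegree ≤ 1) (f : MvPolynomial σ R) :
    (aeval u f).totalDegree ≤ f.totalDegree := by
  rw [aeval_def, eval₂_eq']
  refine totalDegree_finsetSum_le fun s hs => ?_
  refine (totalDegree_mul _ _).trans ?_
  rw [algebraMap_eq, totalDegree_C, zero_add]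
  refine (totalDegree_finsetProd _ _).trans ?_
  refine le_trans (Finset.sum_le_sum (g := fun t => s t) fun t _ => ?_) ?_
  · exact (totalDegree_pow _ _).trans (by nlinarith [hu t])
  · rw [← Finsupp.degree_eq_sum]
    exact le_totalDegree hs

theorem totalDegree_localEquation_le (i : Fin 3) (a : Fin 3 → k) {d : ℕ}
    {f : MvPolynomial (Fin 3) k} (hf : f.IsHomogeneous d) :
    (localEquation i a f).totalDegree ≤ d := by
  rw [localEquation_eq_aeval]
  refine (totalDegree_aeval_le (fun t => ?_) f).trans hf.totalDegree_le
  rcases Fin.eq_self_or_eq_succAbove i t with rfl | ⟨j, rfl⟩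
  · simp
  · rw [Fin.insertNth_apply_succAbove]
    refine (totalDegree_add _ _).trans ?_
    simp

theorem sum_homogeneousComponent_of_totalDegree_le {σ : Type*} {d : ℕ} {F : MvPolynomial σ k}
    (h : F.totalDegree ≤ d) : ∑ j ∈ Finset.range (d + 1), homogeneousComponent j F = F := by
  conv_rhs => rw [← sum_homogeneousComponent F]
  symm
  apply Finset.sum_subset
  · intro j
    simp only [Finset.mem_range]
    omega
  · intro j _ hj
    apply homogeneousComponent_eq_zero
    simpa using hj

/-- The Taylor expansion of a form in terms of the homogeneous components of its local equation. -/
theorem taylorAt_eq_sum {i : Fin 3} {a : Fin 3 → k} (ha : a i ≠ 0) {d : ℕ}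
    {f : MvPolynomial (Fin 3) k} (hf : f.IsHomogeneous d) :
    taylorAt a f = ∑ j ∈ Finset.range (d + 1), (X i + C (a i)) ^ (d - j) *
      lineSubst i (affinePoint i a) (homogeneousComponent j (localEquation i a f)) := by
  -- In the fraction field one may divide by `l = t_i + a_i`: `f(a + t) = l ^ d f((a + t) / l)`, and
  -- `(t_j + a_j) / l = b_j + (t_j - b_j t_i) / l`.
  let Q := FractionRing (MvPolynomial (Fin 3) k)
  let φ : MvPolynomial (Fin 3) k →ₐ[k] Q := IsScalarTower.toAlgHom k _ Q
  have hφ : Function.Injective φ := IsFractionRing.injective (MvPolynomial (Fin 3) k) Q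
  apply hφ
  set l : Q := φ (X i + C (a i)) with hl
  have hl0 : l ≠ 0 := by
    rw [hl, Ne, map_eq_zero_iff φ hφ]
    intro h
    have := congrArg (coeff 0) h
    simp [ha] at this
  set w : Fin 2 → Q := fun j => φ (X (i.succAbove j) - C (affinePoint i a j) * X i) with hw
  have hψ : ∀ G : MvPolynomial (Fin 2) k, φ (lineSubst i (affinePoint i a) G) = aeval w G := by
    intro G
    rw [lineSubst, ← AlgHom.comp_apply, comp_aeval]
  have h₁ : φ (taylorAt a f) =
      aeval (i.insertNth 1 fun j => φ (X (i.succAbove j) + C (a (i.succAbove j))) * l⁻¹ :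
        Fin 3 → Q) f * l ^ d := by
    rw [← IsHomogeneous.aeval_mul_eq hf, taylorAt, ← AlgHom.comp_apply, comp_aeval]
    congr 2
    funext t
    rcases Fin.eq_self_or_eq_succAbove i t with rfl | ⟨j, rfl⟩
    · simp [hl]
    · simp only [Fin.insertNth_apply_succAbove, map_add, mul_assoc,
        inv_mul_cancel₀ hl0, mul_one]
  have h₂ : aeval (i.insertNth 1 fun j => φ (X (i.succAbove j) + C (a (i.succAbove j))) * l⁻¹ :
      Fin 3 → Q) f = aeval (fun j => w j * l⁻¹) (localEquation i a f) := by
    rw [localEquation_eq_aeval, ← AlgHom.comp_apply, comp_aeval]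
    congr 2
    funext t
    rcases Fin.eq_self_or_eq_succAbove i t with rfl | ⟨j, rfl⟩
    · simp
    · simp only [Fin.insertNth_apply_succAbove, map_add, aeval_X, ← algebraMap_eq,
        AlgHom.commutes]
      have hab : algebraMap k Q (a (i.succAbove j)) =
          algebraMap k Q (affinePoint i a j) * algebraMap k Q (a i) := by
        rw [← map_mul, affinePoint, div_mul_cancel₀ _ ha]
      have hl' : l = φ (X i) + algebraMap k Q (a i) := by
        rw [hl, map_add, ← algebraMap_eq, AlgHom.commutes]
      simp only [hw, map_sub, map_mul, ← algebraMap_eq, AlgHom.commutes]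
      rw [hab]
      rw [mul_inv_eq_iff_eq_mul₀ hl0, add_mul, inv_mul_cancel_right₀ hl0, hl']
      ring
  rw [h₁, h₂]
  conv_lhs =>
    rw [← sum_homogeneousComponent_of_totalDegree_le (totalDegree_localEquation_le i a hf)]
  rw [map_sum, map_sum, Finset.sum_mul]
  refine Finset.sum_congr rfl fun j hj => ?_
  have hjd : j ≤ d := by
    rw [Finset.mem_range] at hj; omega
  rw [IsHomogeneous.aeval_mul_eq (homogeneousComponent_isHomogeneous j _), map_mul, map_pow, hψ,
    ← hl, mul_assoc, mul_comm]
  congr 1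
  rw [inv_pow, inv_mul_eq_iff_eq_mul₀ (pow_ne_zero _ hl0), ← pow_add]
  congr 1
  omega

/-! ### Multiplicity and tangents read off the local equation -/

theorem homogeneousComponent_eq_of_sub_mem {σ : Type*} {m : ℕ} {p q : MvPolynomial σ k}
    (h : p - q ∈ idealOfVars σ k ^ (m + 1)) :
    homogeneousComponent m p = homogeneousComponent m q := by
  rw [mem_idealOfVars_pow_iff_homogeneousComponent] at h
  have := h m (Nat.lt_succ_self m)
  rwa [map_sub, sub_eq_zero] at this

/-- In `taylorAt_eq_sum` the terms below `m` vanish, those above have order over `m`, and in the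
`m`-th one `(t_i + a_i) ^ (d - m)` is `a_i ^ (d - m)` modulo `t_i`. -/
theorem taylorAt_sub_mem {i : Fin 3} {a : Fin 3 → k} (ha : a i ≠ 0) {d m : ℕ}
    {f : MvPolynomial (Fin 3) k} (hf : f.IsHomogeneous d)
    (hm : localEquation i a f ∈ idealOfVars (Fin 2) k ^ m) :
    taylorAt a f - C (a i ^ (d - m)) * lineSubst i (affinePoint i a)
      (homogeneousComponent m (localEquation i a f)) ∈ idealOfVars (Fin 3) k ^ (m + 1) := by
  rw [mem_idealOfVars_pow_iff_homogeneousComponent] at hm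
  have hterm : ∀ j, lineSubst i (affinePoint i a) (homogeneousComponent j (localEquation i a f)) ∈
      idealOfVars (Fin 3) k ^ j := fun j =>
    isHomogeneous_mem_idealOfVars_pow
      (lineSubst_isHomogeneous _ _ (homogeneousComponent_isHomogeneous j _))
  by_cases hmd : m ≤ d
  · rw [taylorAt_eq_sum ha hf, ← Finset.add_sum_erase _ _ (Finset.mem_range.mpr
      (Nat.lt_succ_of_le hmd)), add_sub_right_comm]
    refine add_mem ?_ (Ideal.sum_mem _ fun j hj => ?_)
    · rw [← sub_mul, pow_succ']
      refine Ideal.mul_mem_mul ?_ (hterm m)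
      have := sub_dvd_pow_sub_pow (X i + C (a i)) (C (a i)) (d - m)
      rw [add_sub_cancel_right, ← C_pow] at this
      exact Ideal.mem_of_dvd _ this (Ideal.subset_span ⟨i, rfl⟩)
    · have hne := (Finset.mem_erase.mp hj).1
      rcases lt_or_gt_of_ne hne with h | h
      · rw [hm j h, map_zero, mul_zero]
        exact Ideal.zero_mem _
      · exact Ideal.mul_mem_left _ _ (Ideal.pow_le_pow_right h (hterm j))
  -- For `m > d` a local equation of degree at most `d` and order at least `m` is zero, so the
  -- truncated `d - m` is harmless.
  · have hzero : localEquation i a f = 0 := by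
      rw [← sum_homogeneousComponent_of_totalDegree_le (totalDegree_localEquation_le i a hf)]
      refine Finset.sum_eq_zero fun j hj => hm j ?_
      rw [Finset.mem_range] at hj
      omega
    rw [taylorAt_eq_sum ha hf, hzero]
    simp

theorem homogeneousComponent_taylorAt {i : Fin 3} {a : Fin 3 → k} (ha : a i ≠ 0) {d m : ℕ}
    {f : MvPolynomial (Fin 3) k} (hf : f.IsHomogeneous d)
    (hm : localEquation i a f ∈ idealOfVars (Fin 2) k ^ m) :
    homogeneousComponent m (taylorAt a f) = C (a i ^ (d - m)) *
      lineSubst i (affinePoint i a) (homogeneousComponent m (localEquation i a f)) := by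
  rw [homogeneousComponent_eq_of_sub_mem (taylorAt_sub_mem ha hf hm)]
  exact homogeneousComponent_eq_self ((lineSubst_isHomogeneous _ _
    (homogeneousComponent_isHomogeneous m _)).C_mul _)

/-- The two parts of degree `m` vanish together, because `a_i ≠ 0` and `lineSubst` is injective. -/
theorem taylorAt_mem_pow_iff {i : Fin 3} {a : Fin 3 → k} (ha : a i ≠ 0) {d : ℕ} (m : ℕ)
    {f : MvPolynomial (Fin 3) k} (hf : f.IsHomogeneous d) :
    taylorAt a f ∈ idealOfVars (Fin 3) k ^ m ↔
      localEquation i a f ∈ idealOfVars (Fin 2) k ^ m := by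
  induction m with
  | zero => simp
  | succ m ih =>
    constructor
    · intro h
      have hm := ih.mp (Ideal.pow_le_pow_right (Nat.le_succ m) h)
      have h₁ := (mem_idealOfVars_pow_iff_homogeneousComponent.mp h) m (Nat.lt_succ_self m)
      rw [homogeneousComponent_taylorAt ha hf hm, mul_eq_zero, C_eq_zero,
        or_iff_right (pow_ne_zero _ ha), map_eq_zero_iff _ (lineSubst_injective _ _)] at h₁
      have := sub_homogeneousComponent_mem hm
      rwa [h₁, sub_zero] at this
    · intro h
      have h₁ := taylorAt_sub_mem ha hf (Ideal.pow_le_pow_right (Nat.le_succ m) h)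
      rw [mem_idealOfVars_pow_iff_homogeneousComponent.mp h m (Nat.lt_succ_self m), map_zero,
        mul_zero, sub_zero] at h₁
      exact h₁

theorem le_multAt_iff_taylorAt_mem {a : Fin 3 → k} {f : MvPolynomial (Fin 3) k} {m : ℕ} :
    (m : ℕ∞) ≤ multAt a f ↔ taylorAt a f ∈ idealOfVars (Fin 3) k ^ m := by
  rw [mem_pow_idealOfVars_iff', multAt]
  constructor
  · intro h s hs
    rw [← coeff_coe]
    exact MvPowerSeries.coeff_of_lt_order (lt_of_lt_of_le (by exact_mod_cast hs) h)
  · intro h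
    refine MvPowerSeries.nat_le_order fun s hs => ?_
    rw [coeff_coe]
    exact h s hs

theorem le_multAt_iff {i : Fin 3} {a : Fin 3 → k} (ha : a i ≠ 0) {d m : ℕ}
    {f : MvPolynomial (Fin 3) k} (hf : f.IsHomogeneous d) :
    (m : ℕ∞) ≤ multAt a f ↔ localEquation i a f ∈ idealOfVars (Fin 2) k ^ m := by
  rw [le_multAt_iff_taylorAt_mem, taylorAt_mem_pow_iff ha m hf]

theorem multAt_eq_top_iff {a : Fin 3 → k} {f : MvPolynomial (Fin 3) k} :
    multAt a f = ⊤ ↔ f = 0 := by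
  rw [multAt, MvPowerSeries.order_eq_top_iff, coe_eq_zero_iff]
  exact map_eq_zero_iff (translate a) (translate a).injective

theorem one_le_multAt {a : Fin 3 → k} {f : MvPolynomial (Fin 3) k} (h : eval a f = 0) :
    1 ≤ multAt a f := by
  rw [multAt, MvPowerSeries.one_le_order_iff_constCoeff_eq_zero]
  have h₁ : constantCoeff (taylorAt a f) = eval a f := by
    have : constantCoeff.comp (translate a : _ →ₐ[k] MvPolynomial (Fin 3) k).toRingHom =
        eval a := by
      ext t <;> simp [translate_apply]
    exact RingHom.congr_fun this f
  rw [h, constantCoeff_eq, ← coeff_coe] at h₁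
  exact h₁

end Chart

/-! ### Base points of rational maps -/

section BasePoints

variable {K : Type*} [Field K] {n : ℕ}

theorem algebraicIndependent_genericCoeff (K : Type*) [Field K] (n : ℕ) :
    AlgebraicIndependent K (genericCoeff K n) := by
  have h₁ := (MvPolynomial.algebraicIndependent_X (Fin n ⊕ Fin n) K).map'
    (f := IsScalarTower.toAlgHom K _ (FractionRing (MvPolynomial (Fin n ⊕ Fin n) K)))
    (IsFractionRing.injective (MvPolynomial (Fin n ⊕ Fin n) K) _)
  exact h₁.map' (f := IsScalarTower.toAlgHom K _ (GenericField K n))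
    (algebraMap (FractionRing (MvPolynomial (Fin n ⊕ Fin n) K)) (GenericField K n)).injective

theorem dehomogenize_map {L : Type*} [Field L] [Algebra K L] (i : Fin 3)
    (f : MvPolynomial (Fin 3) K) :
    dehomogenize i (map (algebraMap K L) f) = map (algebraMap K L) (dehomogenize i f) := by
  have : (dehomogenize (k := L) i).toRingHom.comp (map (algebraMap K L)) =
      (map (algebraMap K L)).comp (dehomogenize (k := K) i).toRingHom := by
    ext t : 2
    · simp
    · rcases Fin.eq_self_or_eq_succAbove i t with rfl | ⟨j, rfl⟩ <;> simp [dehomogenize]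
  exact RingHom.congr_fun this f

theorem translate_map {L σ : Type*} [Field L] [Algebra K L] (b : σ → K) (f : MvPolynomial σ K) :
    translate (fun j => algebraMap K L (b j)) (map (algebraMap K L) f) =
      map (algebraMap K L) (translate b f) := by
  have : (translate (fun j => algebraMap K L (b j)) : _ →ₐ[L] MvPolynomial σ L).toRingHom.comp
      (map (algebraMap K L)) = (map (algebraMap K L)).comp
        (translate b : MvPolynomial σ K →ₐ[K] MvPolynomial σ K).toRingHom := by
    ext t : 2 <;> simp [translate_apply]
  exact RingHom.congr_fun this f

theorem localEquation_combination {L : Type*} [Field L] [Algebra K L] (i : Fin 3) (a : Fin 3 → K)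
    (c : Fin n → L) (f : Fin n → MvPolynomial (Fin 3) K) :
    localEquation i (fun t => algebraMap K L (a t)) (combination c f) =
      combination c fun j => localEquation i a (f j) := by
  have hb : affinePoint i (fun t => algebraMap K L (a t)) =
      fun j => algebraMap K L (affinePoint i a j) := by
    funext j
    rw [affinePoint, affinePoint, map_div₀]
  rw [localEquation, hb, combination, combination, map_sum, map_sum]
  refine Finset.sum_congr rfl fun j _ => ?_
  rw [map_mul, map_mul, dehomogenize_map, translate_map]
  congr 1
  rw [← algebraMap_eq, AlgHom.commutes, ← algebraMap_eq, AlgEquiv.commutes]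

theorem homogeneousComponent_combination {L σ : Type*} [Field L] [Algebra K L] (m : ℕ)
    (c : Fin n → L) (f : Fin n → MvPolynomial σ K) :
    homogeneousComponent m (combination c f) =
      combination c fun j => homogeneousComponent m (f j) := by
  ext s
  rw [coeff_homogeneousComponent, coeff_combination, coeff_combination]
  simp only [coeff_homogeneousComponent]
  split_ifs <;> simp

theorem combination_mem_pow_iff {L σ : Type*} [Field L] [Algebra K L] {c : Fin n → L}
    (hc : LinearIndependent K c) (m : ℕ) (f : Fin n → MvPolynomial σ K) :
    combination c f ∈ idealOfVars σ L ^ m ↔ ∀ j, f j ∈ idealOfVars σ K ^ m := by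
  simp only [mem_pow_idealOfVars_iff', coeff_combination_eq_zero_iff hc]
  exact ⟨fun h j s hs => h s hs j, fun h s hs j => h j s hs⟩

/-- The multiplicity of a base point is the square of the multiplicity of the generic curve if and
only if the tangents of the curves of least multiplicity have no common component. -/
theorem basePointMult_eq_sq_iff [IsAlgClosed K] {d : ℕ} {f : Fin n → MvPolynomial (Fin 3) K}
    (hf : ∀ i, (f i).IsHomogeneous d) (hgcd : GcdEqOne f) {A : ℙ K (Fin 3 → K)}
    (hA : A ∈ basePoints f) :
    basePointMult f A = multAt (genericRep n A) (genericX f) ^ 2 ↔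
      GcdEqOne (minimalTangents f A) := by
  obtain ⟨j₁, hj₁⟩ : ∃ j, f j ≠ 0 := by
    by_contra! h
    exact not_isUnit_zero (hgcd 0 fun j => by rw [h j])
  have : Nonempty (Fin n) := ⟨j₁⟩
  obtain ⟨j₀, hj₀⟩ := Finite.exists_min fun j => multAt A.rep (f j)
  have hfin : multAt A.rep (f j₀) ≠ ⊤ := fun h => hj₁ (by
    rw [← multAt_eq_top_iff (a := A.rep), ← top_le_iff, ← h]
    exact hj₀ j₁)
  obtain ⟨m', hm'⟩ := ENat.ne_top_iff_exists.mp hfin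
  -- All the curves pass through a base point, so the least multiplicity is positive.
  obtain ⟨m, rfl⟩ : ∃ m, m' = m + 1 := by
    refine Nat.exists_eq_succ_of_ne_zero ?_
    rintro rfl
    have := one_le_multAt (hA j₀)
    rw [← hm'] at this
    simp at this
  simp only [← hm'] at hj₀
  -- This is the chart in which `intersectionMult` is computed; it also contains the point over `K`.
  let i := chartOf (genericRep n A)
  have hiL : genericRep n A i ≠ 0 := by
    apply chartOf_spec
    obtain ⟨t, ht⟩ := Function.ne_iff.mp A.rep_nonzero
    exact Function.ne_iff.mpr ⟨t, (map_ne_zero _).mpr ht⟩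
  have hi : A.rep i ≠ 0 := (map_ne_zero _).mp hiL
  let F : Fin n → MvPolynomial (Fin 2) K := fun j => localEquation i A.rep (f j)
  let x : Fin n → GenericField K n := fun j => genericCoeff K n (Sum.inl j)
  let y : Fin n → GenericField K n := fun j => genericCoeff K n (Sum.inr j)
  have hxy : AlgebraicIndependent K (Sum.elim x y) := by
    convert algebraicIndependent_genericCoeff K n using 1
    funext v
    rcases v with v | v <;> rfl
  have hx : LinearIndependent K x := (hxy.comp Sum.inl Sum.inl_injective).linearIndependent
  have hy : LinearIndependent K y := (hxy.comp Sum.inr Sum.inr_injective).linearIndependent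
  have hX : localEquation i (genericRep n A) (genericX f) = combination x F :=
    localEquation_combination i A.rep x f
  have hY : localEquation i (genericRep n A) (genericY f) = combination y F :=
    localEquation_combination i A.rep y f
  have hF : ∀ j, F j ∈ idealOfVars (Fin 2) K ^ (m + 1) := fun j =>
    (le_multAt_iff hi (hf j)).mp (hj₀ j)
  have hXm := (combination_mem_pow_iff hx (m + 1) F).mpr hF
  have hYm := (combination_mem_pow_iff hy (m + 1) F).mpr hF
  have hXhom : (genericX f).IsHomogeneous d := combination_isHomogeneous x hf
  -- The generic curve has the least multiplicity: order above it would force the same of every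
  -- local equation, including that of `f j₀`.
  have hmult : multAt (genericRep n A) (genericX f) = ((m + 1 : ℕ) : ℕ∞) := by
    apply le_antisymm
    · rw [← not_lt, ← ENat.add_one_le_iff (ENat.natCast_ne_top _)]
      intro h
      have h₁ := (le_multAt_iff (m := m + 1 + 1) hiL hXhom).mp (by exact_mod_cast h)
      rw [hX, combination_mem_pow_iff hx] at h₁
      have h₂ := (le_multAt_iff hi (hf j₀)).mpr (h₁ j₀)
      rw [← hm'] at h₂
      have : m + 1 + 1 ≤ m + 1 := by exact_mod_cast h₂
      omega
    · rw [le_multAt_iff hiL hXhom, hX]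
      exact hXm
  -- The factor `εⱼ` is automatic: a curve of larger multiplicity has no part of degree `m + 1`.
  have htan : minimalTangents f A = fun j => C (A.rep i ^ (d - (m + 1))) *
      lineSubst i (affinePoint i A.rep) (homogeneousComponent (m + 1) (F j)) := by
    funext j
    rw [minimalTangents]
    split_ifs with h
    · have hj : multAt A.rep (f j) = ((m + 1 : ℕ) : ℕ∞) :=
        le_antisymm ((h j₀).trans hm'.ge) (hj₀ j)
      rw [tangents, tangentProduct, hj, ENat.toNat_natCast]
      exact homogeneousComponent_taylorAt hi (hf j) (hF j)
    · have hlt : ((m + 1 : ℕ) : ℕ∞) < multAt A.rep (f j) := by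
        refine lt_of_le_of_ne (hj₀ j) fun he => h fun t => ?_
        rw [← he]
        exact hj₀ t
      have h₁ := (le_multAt_iff (m := m + 1 + 1) hi (hf j)).mp (by
        rw [← ENat.add_one_le_iff (ENat.natCast_ne_top _)] at hlt
        exact_mod_cast hlt)
      have h₂ : homogeneousComponent (m + 1) (F j) = 0 :=
        (mem_idealOfVars_pow_iff_homogeneousComponent.mp h₁) (m + 1) (Nat.lt_succ_self _)
      rw [h₂, map_zero, mul_zero]
  rw [htan, gcdEqOne_lineSubst_iff i _ (pow_ne_zero _ hi), hmult,
    ← noLowRelation_combination_iff hxy fun j => homogeneousComponent_isHomogeneous (m + 1) (F j),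
    ← homogeneousComponent_combination, ← homogeneousComponent_combination, ← hX, ← hY]
  rw [← hX] at hXm
  rw [← hY] at hYm
  exact length_localRing_quotient_eq_sq_iff (affinePoint i (genericRep n A)) hXm hYm

theorem isTransversal_iff [IsAlgClosed K] {d : ℕ} {f : Fin n → MvPolynomial (Fin 3) K}
    (hf : ∀ i, (f i).IsHomogeneous d) (hgcd : GcdEqOne f) :
    IsTransversal f ↔ ∀ A ∈ basePoints f, GcdEqOne (minimalTangents f A) :=
  forall₂_congr fun _ hA => basePointMult_eq_sq_iff hf hgcd hA

/-- Replacing members of a family by zero can only add common divisors. -/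
theorem GcdEqOne.of_minimalTangents {f : Fin n → MvPolynomial (Fin 3) K} {A : ℙ K (Fin 3 → K)}
    (h : GcdEqOne (minimalTangents f A)) : GcdEqOne (tangents f A) := by
  intro g hg
  refine h g fun j => ?_
  rw [minimalTangents]
  split_ifs
  · exact hg j
  · exact dvd_zero g

theorem HasEqualMults.minimalTangents_eq {f : Fin n → MvPolynomial (Fin 3) K}
    (h : HasEqualMults f) {A : ℙ K (Fin 3 → K)} (hA : A ∈ basePoints f) :
    minimalTangents f A = tangents f A := by
  funext j
  rw [minimalTangents, if_pos fun t => (h A hA j t).le]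

theorem transversality_criteria [IsAlgClosed K] {d : ℕ} {f : Fin n → MvPolynomial (Fin 3) K}
    (hf : ∀ i, (f i).IsHomogeneous d) (hgcd : GcdEqOne f) :
    (IsTransversal f ↔ ∀ A ∈ basePoints f, GcdEqOne (minimalTangents f A)) ∧
      (IsTransversal f → ∀ A ∈ basePoints f, GcdEqOne (tangents f A)) ∧
      (HasEqualMults f → (IsTransversal f ↔ ∀ A ∈ basePoints f, GcdEqOne (tangents f A))) := by
  refine ⟨isTransversal_iff hf hgcd, fun h A hA => ?_, fun h => ?_⟩
  · exact ((isTransversal_iff hf hgcd).mp h A hA).of_minimalTangents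
  · rw [isTransversal_iff hf hgcd]
    exact forall₂_congr fun A hA => by rw [h.minimalTangents_eq hA]

end BasePoints

end BaseLocus

end

theorem mainTheorem7 {K : Type*} [Field K] [IsAlgClosed K] [CharZero K] :
    (∀ (d : ℕ) (s : Fin 3 → MvPolynomial (Fin 3) K),
      (∀ i, (s i).IsHomogeneous d) → BaseLocus.GcdEqOne s → BaseLocus.IsBirationalOfPlane s →
        (BaseLocus.IsTransversal s ↔
          ∀ A ∈ BaseLocus.basePoints s, BaseLocus.GcdEqOne (BaseLocus.minimalTangents s A)) ∧
        (BaseLocus.IsTransversal s →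
          ∀ A ∈ BaseLocus.basePoints s, BaseLocus.GcdEqOne (BaseLocus.tangents s A)) ∧
        (BaseLocus.HasEqualMults s →
          (BaseLocus.IsTransversal s ↔
            ∀ A ∈ BaseLocus.basePoints s, BaseLocus.GcdEqOne (BaseLocus.tangents s A)))) ∧
    (∀ (d : ℕ) (p : Fin 4 → MvPolynomial (Fin 3) K),
      (∀ i, (p i).IsHomogeneous d) → BaseLocus.GcdEqOne p →
        BaseLocus.IsBirationalSurfaceParam p →
        (BaseLocus.IsTransversal p ↔
          ∀ A ∈ BaseLocus.basePoints p, BaseLocus.GcdEqOne (BaseLocus.minimalTangents p A)) ∧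
        (BaseLocus.IsTransversal p →
          ∀ A ∈ BaseLocus.basePoints p, BaseLocus.GcdEqOne (BaseLocus.tangents p A)) ∧
        (BaseLocus.HasEqualMults p →
          (BaseLocus.IsTransversal p ↔
            ∀ A ∈ BaseLocus.basePoints p, BaseLocus.GcdEqOne (BaseLocus.tangents p A)))) := by
  exact ⟨fun _ _ hs hgcd _ => BaseLocus.transversality_criteria hs hgcd,
    fun _ _ hp hgcd _ => BaseLocus.transversality_criteria hp hgcd⟩
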